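/- All digraphs are finite. A digraph $H$ with arc set $A(H)$ may have loops and has at most one arc from $u$ to $v$ for each ordered pair $(u,v)$; it is *reflexive* if every vertex has a loop. A linear ordering $<$ of $V(H)$ is a *Min-Max ordering* of $H$ if $i<j$, $s<r$ and $ir, js\in A(H)$ imply $is, jr\in A(H)$. The graph $S(H)$ has vertex set $V(H)$ and edges $uv$ whenever both $uv, vu\in A(H)$; if $H$ is reflexive then so is $S(H)$. The bipartite graph $B(H)$ has two vertices $v', v''$ for each vertex $v$ of $H$, and an edge $v'w''$ for each arc $vw$ of $H$ (including $v=w$). The *converse* of a digraph is obtained by reversing all arcs. *Forbidden graphs in $S(H)$* (taken reflexive, i.e. with a loop at each vertex): the cycles $C_k$, $k\ge 4$; the *claw* $K_{1,3}$; the *net*, a triangle with one pendant vertex attached to each of its vertices; the *tent*, a triangle together with, for each of its three edges, one further vertex adjacent to exactly the two ends of that edge. *Forbidden graphs in $B(H)$* (without loops): the cycles $C_{2k}$, $k\ge 3$; the *biclaw*, a claw with each edge subdivided once; the *binet*, a four-cycle with one pendant vertex attached to each of three of its vertices; the *bitent*, two four-cycles that share one edge and no further vertex, with one pendant vertex attached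 to one end of the shared edge. *Forbidden digraphs in $H$*: the following reflexive digraphs (loops are not listed; $x\rightleftarrows y$ means both arcs $xy$ and $yx$), $H_1$ on $x_1,x_2,x_3$ and the others on $x_1,x_2,x_3,x_4$: - $H_1$: $x_1\rightleftarrows x_2$, $x_1\to x_3$, $x_3\to x_2$; - $H_2$: $x_2\rightleftarrows x_3$, $x_1\to x_2$, $x_2\to x_4$; - $H_3$: $x_1\rightleftarrows x_2$, $x_2\rightleftarrows x_3$, $x_1\to x_3$, $x_2\to x_4$; - $H_4$: $x_1\rightleftarrows x_2$, $x_3\rightleftarrows x_4$, $x_3\to x_1$, $x_2\to x_4$; - $H_5$: $x_1\rightleftarrows x_2$, $x_2\rightleftarrows x_3$, $x_3\to x_1$, $x_1\to x_4$, $x_3\to x_4$; - $H_6$: $x_1\rightleftarrows x_2$, $x_2\rightleftarrows x_3$, $x_1\rightleftarrows x_4$, $x_3\to x_1$, $x_3\to x_4$. **Corollary.** A reflexive digraph $H$ has a Min-Max ordering if and only if all three of the following hold: 1. $S(H)$ contains no induced $C_k$ with $k\ge 4$ and no induced claw, net or tent; 2. $B(H)$ contains no induced $C_{2k}$ with $k\ge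 3$ and no induced biclaw, binet or bitent; 3. $H$ contains no induced subgraph isomorphic to $H_i$ or to the converse of $H_i$, for $i=1,\dots,6$. -/

import Mathlib

open scoped SimpleGraph

namespace MinMaxDigraph

variable {V W : Type*}

/-- A digraph is reflexive if every vertex has a loop. -/
def IsReflexive (H : Digraph V) : Prop := ∀ v, H.Adj v v

/-- The linear order `o` on the vertices is a Min-Max ordering of `H`: whenever `i < j`, `s < r` and
`ir`, `js` are arcs, also `is` and `jr` are arcs. -/
def IsMinMaxOrdering (H : Digraph V) (o : LinearOrder V) : Prop :=
  ∀ i j s r : V, o.lt i j → o.lt s r → H.Adj i r → H.Adj j s → H.Adj i s ∧ H.Adj j r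

/-- `H` has a Min-Max ordering. -/
def HasMinMaxOrdering (H : Digraph V) : Prop :=
  ∃ o : LinearOrder V, IsMinMaxOrdering H o

/-- The symmetric subgraph `S(H)`: two distinct vertices `u`, `v` are adjacent iff both `uv` and
`vu` are arcs. Loops are not recorded: for a reflexive `H` every vertex of `S(H)` has a loop, and so
has every vertex of the graphs sought as induced subgraphs in `S(H)`, so that the loops do not
affect induced containment. -/
def symGraph (H : Digraph V) : SimpleGraph V where
  Adj u v := u ≠ v ∧ H.Adj u v ∧ H.Adj v u
  symm := ⟨fun _ _ h => ⟨h.1.symm, h.2.2, h.2.1⟩⟩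
  loopless := ⟨fun _ h => h.1 rfl⟩

/-- Adjacency in `B(H)`. The white vertex `v'` is `Sum.inl v`, the black vertex `v''` is
`Sum.inr v`, and every arc `vw` of `H` (loops included) gives the edge `v'w''`. -/
def bipAdj (H : Digraph V) : V ⊕ V → V ⊕ V → Prop
  | .inl v, .inr w => H.Adj v w
  | .inr w, .inl v => H.Adj v w
  | _, _ => False

/-- The bipartite graph `B(H)`. -/
def bipGraph (H : Digraph V) : SimpleGraph (V ⊕ V) where
  Adj := bipAdj H
  symm := ⟨by rintro (a | a) (b | b) h <;> exact h⟩
  loopless := ⟨by rintro (a | a) h <;> exact h⟩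

/-- The converse of a digraph: all arcs are reversed. -/
def converse (H : Digraph V) : Digraph V where
  Adj u v := H.Adj v u

/-- `H` contains an induced subgraph isomorphic to the digraph `F`. -/
def ContainsInduced (F : Digraph W) (H : Digraph V) : Prop :=
  Nonempty (F.Adj ↪r H.Adj)

/-- The claw: centre `0` with three leaves. -/
def claw : SimpleGraph (Fin 4) :=
  .fromEdgeSet {s(0, 1), s(0, 2), s(0, 3)}

/-- The net: the triangle `0 1 2` with one pendant vertex attached to each of its vertices. -/
def net : SimpleGraph (Fin 6) :=
  .fromEdgeSet {s(0, 1), s(0, 2), s(1, 2), s(0, 3), s(1, 4), s(2, 5)}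

/-- The tent: the triangle `0 1 2` and, for each of its edges, one further vertex adjacent to
exactly the two ends of that edge. -/
def tent : SimpleGraph (Fin 6) :=
  .fromEdgeSet {s(0, 1), s(0, 2), s(1, 2), s(3, 0), s(3, 1), s(4, 1), s(4, 2), s(5, 0), s(5, 2)}

/-- The biclaw: the claw with each edge subdivided once. -/
def biclaw : SimpleGraph (Fin 7) :=
  .fromEdgeSet {s(0, 1), s(0, 2), s(0, 3), s(1, 4), s(2, 5), s(3, 6)}

/-- The binet: the four-cycle `0 1 2 3` with one pendant vertex attached to each of `0`, `1`,
`3`. -/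
def binet : SimpleGraph (Fin 7) :=
  .fromEdgeSet {s(0, 1), s(1, 2), s(2, 3), s(3, 0), s(0, 4), s(1, 5), s(3, 6)}

/-- The bitent: the two four-cycles `0 1 2 3` and `0 1 4 5`, which share the edge `0 1`, with one
pendant vertex `6` attached to `0`. -/
def bitent : SimpleGraph (Fin 7) :=
  .fromEdgeSet {s(0, 1), s(1, 2), s(2, 3), s(3, 0), s(1, 4), s(4, 5), s(5, 0), s(0, 6)}

/-- The reflexive digraph on `Fin n` whose non-loop arcs are those in the list `A`. -/
def reflexiveOf (n : ℕ) (A : List (Fin n × Fin n)) : Digraph (Fin n) where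
  Adj u v := u = v ∨ (u, v) ∈ A

instance (n : ℕ) (A : List (Fin n × Fin n)) : DecidableRel (reflexiveOf n A).Adj :=
  fun u v => inferInstanceAs (Decidable (u = v ∨ (u, v) ∈ A))

/-! In the digraphs below the vertex `x_{k+1}` is `k : Fin n`. -/

/-- `x₁ ⇄ x₂`, `x₁ → x₃ → x₂`. -/
def H1 : Digraph (Fin 3) := reflexiveOf 3 [(0, 1), (1, 0), (0, 2), (2, 1)]

/-- `x₂ ⇄ x₃`, `x₁ → x₂ → x₄`. -/
def H2 : Digraph (Fin 4) := reflexiveOf 4 [(1, 2), (2, 1), (0, 1), (1, 3)]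

/-- `x₁ ⇄ x₂ ⇄ x₃`, `x₁ → x₃`, `x₂ → x₄`. -/
def H3 : Digraph (Fin 4) := reflexiveOf 4 [(0, 1), (1, 0), (1, 2), (2, 1), (0, 2), (1, 3)]

/-- `x₁ ⇄ x₂`, `x₃ ⇄ x₄`, `x₃ → x₁`, `x₂ → x₄`. -/
def H4 : Digraph (Fin 4) := reflexiveOf 4 [(0, 1), (1, 0), (2, 3), (3, 2), (2, 0), (1, 3)]

/-- `x₁ ⇄ x₂ ⇄ x₃`, `x₃ → x₁`, `x₁ → x₄`, `x₃ → x₄`. -/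
def H5 : Digraph (Fin 4) := reflexiveOf 4 [(0, 1), (1, 0), (1, 2), (2, 1), (2, 0), (0, 3), (2, 3)]

/-- `x₄ ⇄ x₁ ⇄ x₂ ⇄ x₃`, `x₃ → x₁`, `x₃ → x₄`. -/
def H6 : Digraph (Fin 4) :=
  reflexiveOf 4 [(0, 1), (1, 0), (1, 2), (2, 1), (0, 3), (3, 0), (2, 0), (2, 3)]

/-- `H` contains an induced copy of `F` or of the converse of `F`. -/
def ContainsInducedUpToConverse (F : Digraph W) (H : Digraph V) : Prop :=
  ContainsInduced F H ∨ ContainsInduced (converse F) H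

end MinMaxDigraph

open scoped SimpleGraph

namespace MinMaxDigraph

/-! ### Obstructions in 2-coloured graphs -/

section Bipartite

variable {W : Type*} {G : SimpleGraph W} {s : W → Bool}

/-! In a Min-Max ordering, arcs `ac` and `be` for which `ae`, `bc` are not both arcs force `a < b ↔
c < e`. Necessity follows: in each obstruction of fixed size such forced equivalences link a pair to
its own reversal, and in a long cycle a minimal vertex leaves its two neighbours no possible order.

Sufficiency goes through `B(H)`. In each component, take a root `x` admitting the largest possible
connected set that avoids the closed neighbourhood of `x` (`exists_isGoodRoot`). Maximality, with
the excluded subgraphs, controls the first layers around `x`; the biclaw and the binet control the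
later ones. So of two vertices in one distance layer, one has at least the other's neighbours in the
next layer and at most its neighbours in the previous layer (`IsLayering.mono`). Sorting by
component, layer and this comparison orders both sides of `B(H)` without crossings
(`exists_bipartite_rank`).

For `H` this is an order `f` of the vertices as tails and an order `g` of them as heads, with ties
arranged to be exactly the twins. If `f` and `g` disagreed on `u`, `v`, the crossing loops would
give `u ⇄ v`; vertices `y`, `z` telling `u` and `v` apart as tails and as heads would then complete
one of `H1`, ..., `H6`, a claw or a four-cycle (`IsMinMaxPair.not_head_lt`). So `f` and `g` are
compatible, and sorting by `f`, then `g`, is a Min-Max ordering. -/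

theorem isIndContained_of_twinFree {n : ℕ} {F : SimpleGraph (Fin n)} (φ : Fin n → W)
    (hφ : ∀ i j, G.Adj (φ i) (φ j) ↔ F.Adj i j)
    (hF : ∀ i j, (∀ k, F.Adj i k ↔ F.Adj j k) → i = j) : F ⊴ G := by
  refine ⟨⟨⟨φ, fun i j hij => hF i j fun k => ?_⟩, fun {i j} => hφ i j⟩⟩
  rw [← hφ, ← hφ, hij]

/-- Only non-edges between opposite sides need to be supplied: the colouring excludes the others,
and distinctness is automatic since no two vertices of the pattern have the same neighbourhood. -/
theorem biclaw_isIndContained (hs : ∀ a b, G.Adj a b → s a = !s b)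
    (a₀ a₁ a₂ a₃ a₄ a₅ a₆ : W)
    (h01 : G.Adj a₀ a₁) (h02 : G.Adj a₀ a₂) (h03 : G.Adj a₀ a₃)
    (h41 : G.Adj a₄ a₁) (h52 : G.Adj a₅ a₂) (h63 : G.Adj a₆ a₃)
    (n42 : ¬ G.Adj a₄ a₂) (n43 : ¬ G.Adj a₄ a₃) (n51 : ¬ G.Adj a₅ a₁) (n53 : ¬ G.Adj a₅ a₃)
    (n61 : ¬ G.Adj a₆ a₁) (n62 : ¬ G.Adj a₆ a₂) : biclaw ⊴ G := by
  have e1 := hs _ _ h01.symm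
  have e2 := hs _ _ h02.symm
  have e3 := hs _ _ h03.symm
  have e4 := hs _ _ h41
  have e5 := hs _ _ h52
  have e6 := hs _ _ h63
  refine isIndContained_of_twinFree ![a₀, a₁, a₂, a₃, a₄, a₅, a₆] ?_ ?_
  · intro i j
    fin_cases i <;> fin_cases j <;> simp [biclaw] <;>
      first
      | assumption
      | (rw [G.adj_comm]; assumption)
      | (intro h; simpa [e1, e2, e3, e4, e5, e6] using hs _ _ h)
  · simp only [biclaw, SimpleGraph.fromEdgeSet_adj]
    decide

theorem binet_isIndContained (hs : ∀ a b, G.Adj a b → s a = !s b)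
    (a₀ a₁ a₂ a₃ a₄ a₅ a₆ : W)
    (h01 : G.Adj a₀ a₁) (h21 : G.Adj a₂ a₁) (h23 : G.Adj a₂ a₃) (h03 : G.Adj a₀ a₃)
    (h04 : G.Adj a₀ a₄) (h51 : G.Adj a₅ a₁) (h63 : G.Adj a₆ a₃)
    (n24 : ¬ G.Adj a₂ a₄) (n53 : ¬ G.Adj a₅ a₃) (n54 : ¬ G.Adj a₅ a₄) (n61 : ¬ G.Adj a₆ a₁)
    (n64 : ¬ G.Adj a₆ a₄) : binet ⊴ G := by
  have e1 := hs _ _ h01.symm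
  have e2 := hs _ _ h21
  have e3 := hs _ _ h03.symm
  have e4 := hs _ _ h04.symm
  have e5 := hs _ _ h51
  have e6 := hs _ _ h63
  refine isIndContained_of_twinFree ![a₀, a₁, a₂, a₃, a₄, a₅, a₆] ?_ ?_
  · intro i j
    fin_cases i <;> fin_cases j <;> simp [binet] <;>
      first
      | assumption
      | (rw [G.adj_comm]; assumption)
      | (intro h; simpa [e1, e2, e3, e4, e5, e6] using hs _ _ h)
  · simp only [binet, SimpleGraph.fromEdgeSet_adj]
    decide

theorem bitent_isIndContained (hs : ∀ a b, G.Adj a b → s a = !s b)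
    (a₀ a₁ a₂ a₃ a₄ a₅ a₆ : W)
    (h01 : G.Adj a₀ a₁) (h21 : G.Adj a₂ a₁) (h23 : G.Adj a₂ a₃) (h03 : G.Adj a₀ a₃)
    (h41 : G.Adj a₄ a₁) (h45 : G.Adj a₄ a₅) (h05 : G.Adj a₀ a₅) (h06 : G.Adj a₀ a₆)
    (n25 : ¬ G.Adj a₂ a₅) (n26 : ¬ G.Adj a₂ a₆) (n43 : ¬ G.Adj a₄ a₃)
    (n46 : ¬ G.Adj a₄ a₆) : bitent ⊴ G := by
  have e1 := hs _ _ h01.symm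
  have e2 := hs _ _ h21
  have e3 := hs _ _ h03.symm
  have e4 := hs _ _ h41
  have e5 := hs _ _ h05.symm
  have e6 := hs _ _ h06.symm
  refine isIndContained_of_twinFree ![a₀, a₁, a₂, a₃, a₄, a₅, a₆] ?_ ?_
  · intro i j
    fin_cases i <;> fin_cases j <;> simp [bitent] <;>
      first
      | assumption
      | (rw [G.adj_comm]; assumption)
      | (intro h; simpa [e1, e2, e3, e4, e5, e6] using hs _ _ h)
  · simp only [bitent, SimpleGraph.fromEdgeSet_adj]
    decide

/-- A vertex outside an induced path which is adjacent exactly to its ends closes a hole. -/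
theorem cycleGraph_isIndContained {m : ℕ} (hm : 4 ≤ m) (c : ℕ → W) (z : W)
    (hadj : ∀ i < m, G.Adj (c i) (c (i + 1)))
    (hne : ∀ i j, i + 1 < j → j ≤ m → ¬ G.Adj (c i) (c j) ∧ c i ≠ c j)
    (hz : ∀ i ≤ m, G.Adj z (c i) ↔ i = 0 ∨ i = m) :
    SimpleGraph.cycleGraph (m + 2) ⊴ G := by
  have key : ∀ i j : ℕ, i < j → j < m + 2 →
      (G.Adj (if i ≤ m then c i else z) (if j ≤ m then c j else z) ↔
        j = i + 1 ∨ (i = 0 ∧ j = m + 1)) := by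
    intro i j hij hj
    rw [if_pos (by omega : i ≤ m)]
    by_cases hjm : j ≤ m
    · rw [if_pos hjm]
      by_cases h : j = i + 1
      · subst h; simp [hadj i (by omega)]
      · have := (hne i j (by omega) hjm).1
        simp only [this, false_iff]; omega
    · rw [if_neg hjm, G.adj_comm, hz i (by omega)]; omega
  have cyc : ∀ i j : Fin (m + 2), i < j →
      ((SimpleGraph.cycleGraph (m + 2)).Adj i j ↔
        j.val = i.val + 1 ∨ (i.val = 0 ∧ j.val = m + 1)) := by
    intro i j hij
    rw [SimpleGraph.cycleGraph_adj', Fin.sub_val_of_le hij.le, Fin.coe_sub_iff_lt.2 hij]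
    have := i.2
    have := j.2
    have : i.val < j.val := hij
    omega
  have hφ : ∀ i j : Fin (m + 2), G.Adj (if i.val ≤ m then c i else z) (if j.val ≤ m then c j else z)
      ↔ (SimpleGraph.cycleGraph (m + 2)).Adj i j := by
    intro i j
    rcases lt_trichotomy i j with h | h | h
    · rw [cyc i j h, key i j h j.2]
    · subst h; simp
    · rw [G.adj_comm, (SimpleGraph.cycleGraph (m + 2)).adj_comm, cyc j i h, key j i h i.2]
  refine ⟨⟨⟨fun i => if i.val ≤ m then c i else z, ?_⟩, fun {i j} => hφ i j⟩⟩
  have inj : ∀ i j : Fin (m + 2), i < j →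
      (if i.val ≤ m then c i else z) ≠ (if j.val ≤ m then c j else z) := by
    intro i j hij he
    have hij' : i.val < j.val := hij
    rw [if_pos (by omega : i.val ≤ m)] at he
    by_cases hjm : j.val ≤ m
    · rw [if_pos hjm] at he
      by_cases h : j.val = i.val + 1
      · rw [h] at he
        exact (hadj i (by omega)).ne he
      · exact (hne i j (by omega) hjm).2 he
    · rw [if_neg hjm] at he
      have h0 : i.val = 0 := by
        by_contra h0
        have := (hz 0 (by omega)).2 (Or.inl rfl)
        have hm' := (hz m le_rfl).2 (Or.inr rfl)
        rw [← he] at this hm'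
        by_cases h1 : i.val = 1
        · rw [h1] at hm'
          exact (hne 1 m (by omega) le_rfl).1 hm'
        · exact (hne 0 i (by omega) (by omega)).1 this.symm
      have := (hz m le_rfl).2 (Or.inr rfl)
      rw [← he, h0] at this
      exact (hne 0 m (by omega) le_rfl).1 this
  intro i j hij
  rcases lt_trichotomy i j with h | h | h
  · exact absurd hij (inj i j h)
  · exact h
  · exact absurd hij.symm (inj j i h)

/-- `G` is bipartite with sides given by `s`, and contains none of the induced subgraphs that
obstruct a bipartite Min-Max ordering. -/
structure IsObstructionFree (G : SimpleGraph W) (s : W → Bool) : Prop where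
  side : ∀ a b, G.Adj a b → s a = !s b
  hole : ∀ k : ℕ, 3 ≤ k → ¬ SimpleGraph.cycleGraph (2 * k) ⊴ G
  biclaw : ¬ biclaw ⊴ G
  binet : ¬ binet ⊴ G
  bitent : ¬ bitent ⊴ G

/-! ### Induced paths and common neighbours -/

/-- The edges of `G` with both ends in `S`, as a graph on all vertices. -/
def within (G : SimpleGraph W) (S : Set W) : SimpleGraph W where
  Adj a b := G.Adj a b ∧ a ∈ S ∧ b ∈ S
  symm := ⟨fun _ _ h => ⟨h.1.symm, h.2.2, h.2.1⟩⟩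
  loopless := ⟨fun _ h => h.1.ne rfl⟩

theorem within_mono {S T : Set W} (h : S ⊆ T) : within G S ≤ within G T :=
  fun _ _ hab => ⟨hab.1, h hab.2.1, h hab.2.2⟩

/-- Take a shortest walk inside `S`; a chord or a repeated vertex would shorten it. -/
theorem exists_induced_path {S : Set W} {a b : W} (h : (within G S).Reachable a b) (ha : a ∈ S) :
    ∃ (m : ℕ) (c : ℕ → W), c 0 = a ∧ c m = b ∧ (∀ i ≤ m, c i ∈ S) ∧
      (∀ i < m, G.Adj (c i) (c (i + 1))) ∧
      ∀ i j, i + 1 < j → j ≤ m → ¬ G.Adj (c i) (c j) ∧ c i ≠ c j := by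
  obtain ⟨p, hp⟩ := h.exists_walk_length_eq_dist
  have hadj : ∀ i < p.length, (within G S).Adj (p.getVert i) (p.getVert (i + 1)) :=
    fun i hi => p.adj_getVert_succ hi
  have hmem : ∀ i ≤ p.length, p.getVert i ∈ S := by
    rintro (_ | i) hi
    · simpa using ha
    · exact (hadj i hi).2.2
  refine ⟨p.length, p.getVert, by simp, by simp, hmem, fun i hi => (hadj i hi).1, ?_⟩
  intro i j hij hj
  constructor
  · intro hG
    have e : (within G S).Adj (p.getVert i) (p.getVert j) := ⟨hG, hmem i (by omega), hmem j hj⟩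
    have := SimpleGraph.dist_le ((p.take i).append (SimpleGraph.Walk.cons e (p.drop j)))
    simp at this
    omega
  · intro he
    have := SimpleGraph.dist_le ((p.take i).append ((p.drop j).copy he.symm rfl))
    simp at this
    omega

theorem side_path (hs : ∀ a b, G.Adj a b → s a = !s b) {m : ℕ} {c : ℕ → W}
    (hadj : ∀ i < m, G.Adj (c i) (c (i + 1))) :
    ∀ i j, i ≤ j → j ≤ m → (s (c i) = s (c j) ↔ (j - i) % 2 = 0) := by
  intro i j hij
  induction j, hij using Nat.le_induction with
  | base => simp
  | succ j hij ih =>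
    intro hj
    have h1 := ih (by omega)
    have h2 := hs _ _ (hadj j (by omega))
    rw [h2] at h1
    have h3 : s (c i) = s (c (j + 1)) ↔ ¬ s (c i) = !s (c (j + 1)) := by
      cases s (c i) <;> cases s (c (j + 1)) <;> simp
    rw [h3, h1]
    omega

/-- A shortest path from `a` to `b` in `C` has length two, since a longer one yields a hole through
`q` or a bitent with pendant `x`. -/
theorem exists_common_neighbor_of_mem (h : IsObstructionFree G s) {C : Set W} {x q a b : W}
    (hxC : ∀ t ∈ C, ¬ G.Adj x t) (hxq : G.Adj x q) (haC : a ∈ C)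
    (hr : (within G C).Reachable a b) (hqa : G.Adj q a) (hqb : G.Adj q b) (hab : a ≠ b) :
    ∃ y ∈ C, G.Adj y a ∧ G.Adj y b := by
  obtain ⟨m, c, rfl, rfl, hC, hadj, hne⟩ := exists_induced_path hr haC
  have hpar := side_path h.side hadj
  have hqs : ∀ i j, G.Adj q (c i) → G.Adj q (c j) → s (c i) = s (c j) := by
    intro i j hi hj
    rw [h.side _ _ hi.symm, h.side _ _ hj.symm]
  -- Consecutive neighbours of `q` on the path have the same colour, and a gap larger than two would
  -- close a hole.
  have step : ∀ i, i < m → G.Adj q (c i) → i + 2 ≤ m ∧ G.Adj q (c (i + 2)) := by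
    classical
    intro i hi hqi
    have hex : ∃ j, i < j ∧ j ≤ m ∧ G.Adj q (c j) := ⟨m, hi, le_rfl, hqb⟩
    obtain ⟨h1, h2, h3⟩ := Nat.find_spec hex
    have hmin := fun k => Nat.find_min (m := k) hex
    generalize Nat.find hex = j at h1 h2 h3 hmin
    have hp := (hpar i j h1.le h2).1 (hqs i j hqi h3)
    have hj : j = i + 2 := by
      by_contra hj
      refine h.hole ((j - i) / 2 + 1) (by omega) ?_
      have := cycleGraph_isIndContained (G := G) (m := j - i) (by omega) (fun k => c (i + k)) q
        (fun k hk => hadj (i + k) (by omega))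
        (fun k l hkl hl => hne (i + k) (i + l) (by omega) (by omega)) ?_
      · rwa [show 2 * ((j - i) / 2 + 1) = j - i + 2 by omega]
      · intro k hk
        constructor
        · intro hk'
          by_contra hcon
          exact hmin (i + k) (by omega) ⟨by omega, by omega, hk'⟩
        · rintro (rfl | rfl)
          · simpa using hqi
          · rwa [show i + (j - i) = j by omega]
    subst hj
    exact ⟨h2, h3⟩
  have hm0 : m ≠ 0 := by rintro rfl; exact hab rfl
  obtain ⟨hm2, hq2⟩ := step 0 (by omega) hqa
  rcases hm2.eq_or_lt with rfl | hm2
  · exact ⟨c 1, hC 1 (by omega), (hadj 0 (by omega)).symm, hadj 1 (by omega)⟩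
  -- Now `q` sees `c 0`, `c 2`, `c 4`: two four-cycles share the edge from `q` to `c 2`, and `x`
  -- hangs at `q`.
  · obtain ⟨hm4, hq4⟩ := step 2 (by omega) hq2
    exact absurd (bitent_isIndContained h.side q (c 2) (c 1) (c 0) (c 3) (c 4) x hq2
      (hadj 1 (by omega)) (hadj 0 (by omega)).symm hqa (hadj 2 (by omega)).symm (hadj 3 (by omega))
      hq4 hxq.symm (hne 1 4 (by omega) hm4).1 (fun e => hxC _ (hC 1 (by omega)) e.symm)
      (fun e => (hne 0 3 (by omega) (by omega)).1 e.symm)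
      (fun e => hxC _ (hC 3 (by omega)) e.symm)) h.bitent

/-- A shortest path from `p` to `p'` through `C` has its interior in `C`, hence out of reach of `x`;
unless its length is two, `x` closes it to a hole. -/
theorem exists_common_neighbor_of_attached (h : IsObstructionFree G s) {C : Set W} {x p p' a b : W}
    (hxC : ∀ t ∈ C, ¬ G.Adj x t) (hC : ∀ a ∈ C, ∀ b ∈ C, (within G C).Reachable a b)
    (hxp : G.Adj x p) (hxp' : G.Adj x p') (hpp' : p ≠ p') (ha : a ∈ C) (hb : b ∈ C)
    (hpa : G.Adj p a) (hpb : G.Adj p' b) : ∃ y ∈ C, G.Adj p y ∧ G.Adj p' y := by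
  have hr : (within G (insert p (insert p' C))).Reachable p p' := by
    have h1 : (within G (insert p (insert p' C))).Adj p a := ⟨hpa, by simp, by simp [ha]⟩
    have h2 : (within G (insert p (insert p' C))).Adj b p' := ⟨hpb.symm, by simp [hb], by simp⟩
    have h3 := (hC a ha b hb).mono (within_mono (T := insert p (insert p' C))
      (fun t ht => by simp [ht]))
    exact h1.reachable.trans (h3.trans h2.reachable)
  obtain ⟨m, c, h0, hm, hS, hadj, hne⟩ := exists_induced_path hr (by simp)
  have hpar := (side_path h.side hadj 0 m (by omega) le_rfl).1 (by
    rw [h0, hm, h.side _ _ hxp.symm, h.side _ _ hxp'.symm])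
  have hm0 : m ≠ 0 := by rintro rfl; exact hpp' (h0.symm.trans hm)
  have hint : ∀ i, 0 < i → i < m → c i ∈ C := by
    intro i hi him
    have n1 : c i ≠ p := by
      rw [← h0]
      by_cases h1 : i = 1
      · subst h1; exact (hadj 0 (by omega)).ne'
      · exact (hne 0 i (by omega) (by omega)).2.symm
    have n2 : c i ≠ p' := by
      rw [← hm]
      by_cases h1 : i + 1 = m
      · subst h1; exact (hadj i (by omega)).ne
      · exact (hne i m (by omega) (by omega)).2
    simpa [n1, n2] using hS i him.le
  by_cases hm2 : m = 2
  · subst hm2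
    refine ⟨c 1, hint 1 (by omega) (by omega), ?_, ?_⟩
    · rw [← h0]; exact hadj 0 (by omega)
    · rw [← hm]; exact (hadj 1 (by omega)).symm
  · refine absurd ?_ (h.hole (m / 2 + 1) (by omega))
    rw [show 2 * (m / 2 + 1) = m + 2 by omega]
    refine cycleGraph_isIndContained (by omega) c x hadj hne fun i hi => ⟨fun hxi => ?_, ?_⟩
    · by_contra hcon
      exact hxC _ (hint i (by omega) (by omega)) hxi
    · rintro (rfl | rfl)
      · rwa [h0]
      · rwa [hm]

/-- The three long diagonals are the only chords the colouring allows; their absence also makes the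
vertices distinct. -/
theorem hexagon_false (h : IsObstructionFree G s) {a₀ a₁ a₂ a₃ a₄ a₅ : W}
    (h01 : G.Adj a₀ a₁) (h12 : G.Adj a₁ a₂) (h23 : G.Adj a₂ a₃) (h34 : G.Adj a₃ a₄)
    (h45 : G.Adj a₄ a₅) (h50 : G.Adj a₅ a₀) (n03 : ¬ G.Adj a₀ a₃) (n14 : ¬ G.Adj a₁ a₄)
    (n25 : ¬ G.Adj a₂ a₅) : False := by
  have e1 := h.side _ _ h01.symm
  have e2 := h.side _ _ h12.symm
  have e3 := h.side _ _ h23.symm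
  have e4 := h.side _ _ h34.symm
  have e5 := h.side _ _ h45.symm
  have same : ∀ {a b}, s a = s b → ¬ G.Adj a b := fun hab hG => by
    have := h.side _ _ hG
    rw [hab] at this
    simp at this
  let c : ℕ → W := fun
    | 0 => a₀
    | 1 => a₁
    | 2 => a₂
    | 3 => a₃
    | _ => a₄
  refine h.hole 3 le_rfl (cycleGraph_isIndContained (m := 4) le_rfl c a₅ ?_ ?_ ?_)
  · intro i hi
    interval_cases i <;> assumption
  · have d2 : ∀ {a b}, s a = s b → a ≠ b → ¬ G.Adj a b ∧ a ≠ b :=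
      fun h1 h2 => ⟨same h1, h2⟩
    have d3 : ∀ {a b}, ¬ G.Adj a b → s a ≠ s b → ¬ G.Adj a b ∧ a ≠ b :=
      fun h1 h2 => ⟨h1, fun e => h2 (congrArg s e)⟩
    intro i j hij hj
    have hi : i ≤ 2 := by omega
    interval_cases i <;> interval_cases j
    · exact d2 (by simp [c, e1, e2]) (fun e => n25 (by rw [← show a₀ = a₂ from e]; exact h50.symm))
    · exact d3 n03 (by simp [c, e1, e2, e3])
    · exact d2 (by simp [c, e1, e2, e3, e4])
        (fun e => n03 (by rw [show a₀ = a₄ from e]; exact h34.symm))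
    · exact d2 (by simp [c, e2, e3]) (fun e => n14 (by rw [show a₁ = a₃ from e]; exact h34))
    · exact d3 n14 (by simp [c, e2, e3, e4])
    · exact d2 (by simp [c, e3, e4]) (fun e => n25 (by rw [show a₂ = a₄ from e]; exact h45))
  · intro i hi
    interval_cases i
    · simpa [c] using h50
    · simpa [c] using same (by simp [e2, e3, e4, e5])
    · simpa [c] using fun e => n25 e.symm
    · simpa [c] using same (by simp [e4, e5])
    · simpa [c] using h45.symm

/-! ### Choosing a root -/

/-- A vertex from which a connected bipartite graph can be laid out in layers: it is not in the
middle of an obstruction to nestedness of neighbourhoods. -/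
structure IsGoodRoot (G : SimpleGraph W) (x : W) : Prop where
  near : ∀ p p' u v, G.Adj x p → G.Adj x p' → G.Adj u p → ¬ G.Adj u p' → G.Adj v p' →
    ¬ G.Adj v p → False
  far : ∀ q p p' u v, G.Adj x q → G.Adj q p → G.Adj q p' → G.Adj u p → ¬ G.Adj u p' →
    G.Adj v p' → ¬ G.Adj v p → ¬ G.Adj x u → ¬ G.Adj x v → False
  mixed : ∀ p p' u v w, G.Adj x p → G.Adj x p' → G.Adj u p → G.Adj u p' → G.Adj v p' →
    ¬ G.Adj v p → G.Adj w u → ¬ G.Adj w v → ¬ G.Adj x w → False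

/-- `C` is a connected set of vertices of the component of `v₀` that avoids the closed
neighbourhood of `x`. -/
structure IsAvoiding (G : SimpleGraph W) (v₀ x : W) (C : Set W) : Prop where
  root : G.Reachable v₀ x
  mem : ∀ t ∈ C, t ≠ x ∧ ¬ G.Adj x t ∧ G.Reachable v₀ t
  conn : ∀ a ∈ C, ∀ b ∈ C, (within G C).Reachable a b

/-- The root may move from `x` to `y` while the avoiding set gains a vertex; this is what
contradicts maximality. -/
theorem IsAvoiding.insert_of_adj {v₀ x y a b : W} {C : Set W} (hC : IsAvoiding G v₀ x C)
    (hy : G.Reachable v₀ y) (hCy : ∀ t ∈ C, t ≠ y ∧ ¬ G.Adj y t) (hb : b ∈ C)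
    (hab : G.Adj a b) (hay : a ≠ y) (hya : ¬ G.Adj y a) :
    IsAvoiding G v₀ y (insert a C) := by
  refine ⟨hy, ?_, ?_⟩
  · rintro t (rfl | ht)
    · exact ⟨hay, hya, (hC.mem b hb).2.2.trans hab.symm.reachable⟩
    · exact ⟨(hCy t ht).1, (hCy t ht).2, (hC.mem t ht).2.2⟩
  · have key : ∀ t ∈ insert a C, (within G (insert a C)).Reachable b t := by
      rintro t (rfl | ht)
      · exact SimpleGraph.Adj.reachable ⟨hab.symm, by simp [hb], by simp⟩
      · exact (hC.conn b hb t ht).mono (within_mono (Set.subset_insert _ _))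
    exact fun t ht t' ht' => (key t ht).symm.trans (key t' ht')

theorem exists_isGoodRoot [Finite W] (h : IsObstructionFree G s) (v₀ : W) :
    ∃ x, G.Reachable v₀ x ∧ IsGoodRoot G x := by
  obtain ⟨⟨⟨x, C⟩, hC⟩, hmax⟩ : ∃ y : {y : W × Set W // IsAvoiding G v₀ y.1 y.2},
      ∀ z : {y : W × Set W // IsAvoiding G v₀ y.1 y.2}, z.1.2.ncard ≤ y.1.2.ncard := by
    have : Nonempty {y : W × Set W // IsAvoiding G v₀ y.1 y.2} :=
      ⟨⟨(v₀, ∅), ⟨.refl _, by simp, by simp⟩⟩⟩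
    exact Finite.exists_max _
  have hC : IsAvoiding G v₀ x C := hC
  have hmax : ∀ y D, IsAvoiding G v₀ y D → D.ncard ≤ C.ncard := fun y D hD => hmax ⟨(y, D), hD⟩
  have hxC : ∀ t ∈ C, ¬ G.Adj x t := fun t ht => (hC.mem t ht).2.1
  have grow : ∀ y a b, G.Reachable v₀ y → (∀ t ∈ C, t ≠ y ∧ ¬ G.Adj y t) → b ∈ C → G.Adj a b →
      a ∉ C → a ≠ y → G.Adj y a := by
    intro y a b hy hCy hb hab haC hay
    by_contra hya
    have := hmax _ _ (hC.insert_of_adj hy hCy hb hab hay hya)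
    rw [Set.ncard_insert_of_notMem haC] at this
    omega
  -- By maximality `C` can be left only through neighbours of `x`.
  have closed : ∀ t ∈ C, ∀ a, G.Adj a t → ¬ G.Adj x a → a ∈ C := by
    intro t ht a hat hxa
    by_contra haC
    refine hxa (grow x a t hC.root (fun t ht => ⟨(hC.mem t ht).1, hxC t ht⟩) ht hat haC ?_)
    rintro rfl
    exact hxC t ht hat
  have reach : ∀ {a b}, G.Adj a b → G.Reachable v₀ a → G.Reachable v₀ b :=
    fun hab ha => ha.trans hab.reachable
  -- `C` is nonempty by comparison with `{u}`. Were it not attached to a neighbour of `x`, it would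
  -- be a whole component and contain `x`.
  have attach : ∀ u, G.Reachable v₀ u → u ≠ x → ¬ G.Adj x u →
      ∃ p, G.Adj x p ∧ ∃ t ∈ C, G.Adj p t := by
    intro u hu hux hxu
    obtain ⟨c₀, hc₀⟩ : C.Nonempty := by
      by_contra hne
      rw [Set.not_nonempty_iff_eq_empty] at hne
      subst hne
      have := hmax x {u} ⟨hC.root, by rintro t rfl; exact ⟨hux, hxu, hu⟩,
        by rintro a rfl b rfl; rfl⟩
      simp at this
    by_contra hno
    push Not at hno
    have stay : ∀ t, G.Reachable c₀ t → t ∈ C := by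
      intro t ht
      rw [SimpleGraph.reachable_iff_reflTransGen] at ht
      induction ht with
      | refl => exact hc₀
      | tail _ hab ih =>
        exact closed _ ih _ hab.symm fun hx => hno _ hx _ ih hab.symm
    exact (hC.mem x (stay x (((hC.mem c₀ hc₀).2.2.symm).trans hC.root))).1 rfl
  -- Otherwise the root `u` with the set `C ∪ {p}` would beat the maximal choice.
  have outside : ∀ u p t, G.Reachable v₀ u → u ≠ x → ¬ G.Adj x u → u ∉ C → G.Adj x p → t ∈ C →
      G.Adj p t → G.Adj u p := by
    intro u p t hu hux hxu huC hxp ht hpt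
    refine grow u p t hu (fun t' ht' => ⟨fun e => huC (e ▸ ht'),
      fun hut => huC (closed t' ht' u hut hxu)⟩)
      ht hpt (fun hpC => hxC p hpC hxp) (fun e => hxu (e ▸ hxp))
  have opp : ∀ {a b}, G.Adj a b → s a = !s b := fun hab => h.side _ _ hab
  have sameside : ∀ {a b c}, G.Adj a b → G.Adj b c → ¬ G.Adj a c := by
    intro a b c hab hbc hac
    have e1 := opp hab
    have e2 := opp hbc
    have e3 := opp hac
    rw [e1, e2] at e3
    simp at e3
  have oppmem : ∀ u p, G.Reachable v₀ u → ¬ G.Adj x u → G.Adj x p → s u = s p → u ∈ C := by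
    intro u p hu hxu hxp hup
    by_contra huC
    have hux : u ≠ x := by
      rintro rfl
      have := opp hxp
      rw [hup] at this
      simp at this
    obtain ⟨p₀, hp₀, t, ht, hpt⟩ := attach u hu hux hxu
    have h1 := opp (outside u p₀ t hu hux hxu huC hp₀ ht hpt)
    have h2 := opp hp₀.symm
    have h3 := opp hxp.symm
    rw [hup, h3, h2] at h1
    simp at h1
  have fan : ∀ q a b, a ∈ C → b ∈ C → G.Adj x q → G.Adj q a → G.Adj q b → a ≠ b →
      ∃ y ∈ C, G.Adj y a ∧ G.Adj y b := fun q a b ha hb hxq hqa hqb hab =>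
    exists_common_neighbor_of_mem h hxC hxq ha (hC.conn a ha b hb) hqa hqb hab
  refine ⟨x, hC.root, ?_, ?_, ?_⟩
  · intro p p' u v hxp hxp' hup hup' hvp' hvp
    have hxu : ¬ G.Adj x u := sameside hxp hup.symm
    have hxv : ¬ G.Adj x v := sameside hxp' hvp'.symm
    have hux : u ≠ x := fun e => hup' (e ▸ hxp')
    have hvx : v ≠ x := fun e => hvp (e ▸ hxp)
    have hpp' : p ≠ p' := fun e => hup' (e ▸ hup)
    have hu := reach hup.symm (reach hxp hC.root)
    have hv := reach hvp'.symm (reach hxp' hC.root)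
    by_cases huv : u ∈ C ∧ v ∈ C
    -- Inside `C` the common neighbours `c`, `d`, `d'` produce an induced hexagon or a bitent.
    · obtain ⟨huC, hvC⟩ := huv
      obtain ⟨c, hc, hpc, hpc'⟩ := exists_common_neighbor_of_attached h hxC hC.conn hxp hxp' hpp'
        huC hvC hup.symm hvp'.symm
      obtain ⟨d, hd, hdu, hdc⟩ := fan p u c huC hc hxp hup.symm hpc (fun e => hup' (e ▸ hpc'.symm))
      obtain ⟨d', hd', hdv, hdc'⟩ := fan p' v c hvC hc hxp' hvp'.symm hpc'
        (fun e => hvp (e ▸ hpc.symm))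
      by_cases n1 : G.Adj d v
      · exact hexagon_false h hxp hup.symm hdu.symm n1 hvp' hxp'.symm (hxC d hd)
          (fun e => hvp e.symm) hup'
      by_cases n2 : G.Adj d' u
      · exact hexagon_false h hxp hup.symm n2.symm hdv hvp' hxp'.symm (hxC d' hd')
          (fun e => hvp e.symm) hup'
      exact h.bitent (bitent_isIndContained h.side c p x p' u d d' hpc.symm hxp hxp' hpc'.symm hup
        hdu.symm hdc.symm hdc'.symm (hxC d hd) (hxC d' hd') hup' (fun e => n2 e.symm))
    -- Here both `u` and `v` lie outside `C`, since one outside would be adjacent to the attachment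
    -- of one inside. The bitent has shared edge `p₀x` and pendant `t ∈ C`.
    · obtain ⟨p₀, hp₀, t, ht, hpt⟩ := attach u hu hux hxu
      have hnot : u ∉ C ∧ v ∉ C := by
        by_cases huC : u ∈ C
        · have hvC : v ∉ C := fun hvC => huv ⟨huC, hvC⟩
          exact absurd (outside v p u hv hvx hxv hvC hxp huC hup.symm) hvp
        · refine ⟨huC, fun hvC => ?_⟩
          exact absurd (outside u p' v hu hux hxu huC hxp' hvC hvp'.symm) hup'
      have hu0 := outside u p₀ t hu hux hxu hnot.1 hp₀ ht hpt
      have hv0 := outside v p₀ t hv hvx hxv hnot.2 hp₀ ht hpt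
      exact h.bitent (bitent_isIndContained h.side p₀ x p u p' v t hp₀.symm hxp.symm hup.symm
        hu0.symm hxp'.symm hvp'.symm hv0.symm hpt (fun e => hvp e.symm)
        (fun e => hvp (outside v p t hv hvx hxv hnot.2 hxp ht e)) (fun e => hup' e.symm)
        (fun e => hup' (outside u p' t hu hux hxu hnot.1 hxp' ht e)))
  · intro q p p' u v hxq hqp hqp' hup hup' hvp' hvp hxu hxv
    have hp := reach hqp (reach hxq hC.root)
    have hp' := reach hqp' (reach hxq hC.root)
    have huC : u ∈ C := oppmem u q (reach hup.symm hp) hxu hxq (by rw [opp hup, opp hqp])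
    have hvC : v ∈ C := oppmem v q (reach hvp'.symm hp') hxv hxq (by rw [opp hvp', opp hqp'])
    have hpC : p ∈ C := closed u huC p hup.symm (sameside hxq hqp)
    have hpC' : p' ∈ C := closed v hvC p' hvp'.symm (sameside hxq hqp')
    obtain ⟨y, hy, hyp, hyp'⟩ := fan q p p' hpC hpC' hxq hqp hqp' (fun e => hup' (e ▸ hup))
    exact h.binet (binet_isIndContained h.side q p y p' x u v hqp hyp hyp' hqp' hxq.symm hup hvp'
      (fun e => hxC y hy e.symm) hup' (fun e => hxu e.symm) hvp (fun e => hxv e.symm))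
  · intro p p' u v w hxp hxp' hup hup' hvp' hvp hwu hwv hxw
    have hxu : ¬ G.Adj x u := sameside hxp hup.symm
    have hxv : ¬ G.Adj x v := sameside hxp' hvp'.symm
    have hvx : v ≠ x := fun e => hvp (e ▸ hxp)
    have hu := reach hup.symm (reach hxp hC.root)
    have hv := reach hvp'.symm (reach hxp' hC.root)
    have hwC : w ∈ C := oppmem w p (reach hwu.symm hu) hxw hxp (by rw [opp hwu, opp hup.symm])
    have huC : u ∈ C := closed w hwC u hwu.symm hxu
    have hvC : v ∈ C := by
      by_contra hvC
      exact hvp (outside v p u hv hvx hxv hvC hxp huC hup.symm)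
    obtain ⟨y, hy, hyu, hyv⟩ := fan p' u v huC hvC hxp' hup'.symm hvp'.symm
      (fun e => hwv (e ▸ hwu))
    exact h.bitent (bitent_isIndContained h.side u p' x p v y w hup' hxp' hxp hup hvp' hyv.symm
      hyu.symm hwu.symm (hxC y hy) hxw hvp (fun e => hwv e.symm))

/-! ### Distance layers -/

/-- `r` chooses a good root in each component of `G`, and `d` is the distance from it. -/
structure IsLayering (G : SimpleGraph W) (r : W → W) (d : W → ℕ) : Prop where
  good : ∀ v, IsGoodRoot G (r v)
  root_eq : ∀ u v, G.Adj u v → r u = r v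
  eq_root : ∀ v, d v = 0 → v = r v
  adj : ∀ u v, G.Adj u v → d u = d v + 1 ∨ d v = d u + 1
  parent : ∀ v k, d v = k + 1 → ∃ u, G.Adj v u ∧ d u = k

/-- Distances from the root are used; colours fix the parity of walks, so no edge joins two vertices
of one layer. -/
theorem exists_isLayering [Finite W] (h : IsObstructionFree G s) :
    ∃ r d, IsLayering G r d := by
  choose f hf using exists_isGoodRoot h
  let r : W → W := fun v => f (G.connectedComponentMk v).out
  have hr : ∀ v, G.Reachable (r v) v := by
    intro v
    refine ((hf _).1.symm).trans ?_
    rw [← SimpleGraph.ConnectedComponent.eq]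
    exact Quot.out_eq _
  have hroot : ∀ u v, G.Reachable u v → r u = r v := by
    intro u v huv
    simp only [r]
    rw [SimpleGraph.ConnectedComponent.eq.2 huv]
  have hwalk : ∀ {u v} (p : G.Walk u v), (s u = s v ↔ p.length % 2 = 0) := by
    intro u v p
    induction p with
    | nil => simp
    | @cons a b c hab q ih =>
      rw [h.side _ _ hab, SimpleGraph.Walk.length_cons]
      have h3 : (!s b) = s c ↔ ¬ s b = s c := by
        cases s b <;> cases s c <;> simp
      rw [h3, ih]
      omega
  have hadj : ∀ u v, G.Adj u v → G.dist (r u) u = G.dist (r v) v + 1 ∨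
      G.dist (r v) v = G.dist (r u) u + 1 := by
    intro u v huv
    have e := hroot u v huv.reachable
    have hu := hr u
    rw [e] at hu ⊢
    obtain ⟨p, hp⟩ := hu.exists_walk_length_eq_dist
    obtain ⟨q, hq⟩ := (hr v).exists_walk_length_eq_dist
    have h1 := hwalk p
    have h2 := hwalk q
    have h3 := h.side _ _ huv
    have h4 := SimpleGraph.dist_le (p.concat huv)
    have h5 := SimpleGraph.dist_le (q.concat huv.symm)
    rw [SimpleGraph.Walk.length_concat] at h4 h5
    have h6 : ¬ (s (r v) = s u ↔ s (r v) = s v) := by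
      rw [h3]
      cases s (r v) <;> cases s v <;> simp
    rw [h1, h2, hp, hq] at h6
    omega
  refine ⟨r, fun v => G.dist (r v) v, fun v => (hf _).2, fun u v huv => hroot u v huv.reachable, ?_,
    hadj, ?_⟩
  · intro v hv
    exact ((hr v).dist_eq_zero_iff.1 hv).symm
  · intro v k hk
    obtain ⟨p, hp⟩ := (hr v).symm.exists_walk_length_eq_dist
    rw [SimpleGraph.dist_comm] at hp
    have aux : ∀ x (p : G.Walk v x), p.length = k + 1 → ∃ u, G.Adj v u ∧ G.dist u x ≤ k := by
      intro x p hp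
      cases p with
      | nil => simp at hp
      | @cons _ u _ hvu q =>
        rw [SimpleGraph.Walk.length_cons] at hp
        exact ⟨u, hvu, (SimpleGraph.dist_le q).trans (by omega)⟩
    obtain ⟨u, hvu, hu⟩ := aux _ p (hp.trans hk)
    refine ⟨u, hvu, ?_⟩
    rw [SimpleGraph.dist_comm, ← hroot u v hvu.reachable.symm] at hu
    have := hadj v u hvu
    omega

variable {r : W → W} {d : W → ℕ}

namespace IsLayering

theorem not_adj (hl : IsLayering G r d) {a b : W} (h1 : d a ≠ d b + 1) (h2 : d b ≠ d a + 1) :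
    ¬ G.Adj a b := fun h => (hl.adj a b h).elim h1 h2

/-- Induction through the layers: nestedness one layer down gives `p` and `p'` a common parent `q`.
The good root settles `q` in layers 0 and 1; further out, a path of length two from `q` towards the
root completes a biclaw. -/
theorem nested (hl : IsLayering G r d) (h : IsObstructionFree G s) (i : ℕ) :
    ∀ u v p p', G.Adj u p → ¬ G.Adj u p' → G.Adj v p' → ¬ G.Adj v p → d u = i + 1 →
      d v = i + 1 → d p = i → d p' = i → r p = r p' → False := by
  induction i with
  | zero =>
    intro u v p p' hup hup' _ _ _ _ hp hp' e
    rw [hl.eq_root p hp, e, ← hl.eq_root p' hp'] at hup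
    exact hup' hup
  | succ i ih =>
    intro u v p p' hup hup' hvp' hvp hu hv hp hp' e
    obtain ⟨q, hq, hqp, hqp'⟩ : ∃ q, d q = i ∧ G.Adj q p ∧ G.Adj q p' := by
      obtain ⟨a, hpa, ha⟩ := hl.parent p i hp
      obtain ⟨b, hpb, hb⟩ := hl.parent p' i hp'
      by_cases h1 : G.Adj p' a
      · exact ⟨a, ha, hpa.symm, h1.symm⟩
      by_cases h2 : G.Adj p b
      · exact ⟨b, hb, h2.symm, hpb.symm⟩
      refine (ih p p' a b hpa h2 hpb h1 hp hp' ha hb ?_).elim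
      rw [← hl.root_eq p a hpa, ← hl.root_eq p' b hpb, e]
    rcases i with _ | i
    · rw [hl.eq_root q hq] at hqp hqp'
      exact (hl.good q).near p p' u v hqp hqp' hup hup' hvp' hvp
    obtain ⟨t, hqt, ht⟩ := hl.parent q i hq
    rcases i with _ | i
    · rw [hl.eq_root t ht] at hqt
      have h0 : d (r t) = 0 := by rw [← hl.eq_root t ht]; exact ht
      exact (hl.good t).far q p p' u v hqt.symm hqp hqp' hup hup' hvp' hvp
        (hl.not_adj (by omega) (by omega)) (hl.not_adj (by omega) (by omega))
    obtain ⟨z, htz, hz⟩ := hl.parent t i ht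
    exact h.biclaw (biclaw_isIndContained h.side q p p' t u v z hqp hqp' hqt hup hvp' htz.symm hup'
      (hl.not_adj (by omega) (by omega)) hvp (hl.not_adj (by omega) (by omega))
      (hl.not_adj (by omega) (by omega)) (hl.not_adj (by omega) (by omega)))

theorem common_parent (hl : IsLayering G r d) (h : IsObstructionFree G s) {p p' : W} {i : ℕ}
    (hp : d p = i + 1) (hp' : d p' = i + 1) (e : r p = r p') :
    ∃ q, d q = i ∧ G.Adj q p ∧ G.Adj q p' := by
  obtain ⟨a, hpa, ha⟩ := hl.parent p i hp
  obtain ⟨b, hpb, hb⟩ := hl.parent p' i hp'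
  by_cases h1 : G.Adj p' a
  · exact ⟨a, ha, hpa.symm, h1.symm⟩
  by_cases h2 : G.Adj p b
  · exact ⟨b, hb, h2.symm, hpb.symm⟩
  refine (hl.nested h i p p' a b hpa h2 hpb h1 hp hp' ha hb ?_).elim
  rw [← hl.root_eq p a hpa, ← hl.root_eq p' b hpb, e]

/-- A vertex cannot gain over another in both directions: the two would share parents that in turn
share a parent, giving a binet, or `IsGoodRoot.mixed` when that parent is the root. -/
theorem not_mixed (hl : IsLayering G r d) (h : IsObstructionFree G s) {u v w p : W}
    (huw : G.Adj u w) (hvw : ¬ G.Adj v w) (hup : G.Adj u p) (hvp : ¬ G.Adj v p) (huv : d u = d v)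
    (hw : d w = d u + 1) (hp : d u = d p + 1) (e : r u = r v) : False := by
  obtain ⟨p', hvp', hp'⟩ := hl.parent v (d p) (by omega)
  have epp : r p = r p' := by rw [← hl.root_eq u p hup, ← hl.root_eq v p' hvp', e]
  have hup' : G.Adj u p' := by
    by_contra hup'
    exact hl.nested h (d p) u v p p' hup hup' hvp' hvp hp (by omega) rfl hp' epp
  obtain ⟨i, hi⟩ : ∃ i, d p = i := ⟨_, rfl⟩
  rcases i with _ | i
  · rw [hl.eq_root p hi, epp, ← hl.eq_root p' (by omega)] at hvp
    exact hvp hvp'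
  obtain ⟨q, hq, hqp, hqp'⟩ := hl.common_parent h hi (by omega : d p' = i + 1) epp
  rcases i with _ | i
  · rw [hl.eq_root q hq] at hqp hqp'
    have h0 : d (r q) = 0 := by rw [← hl.eq_root q hq]; exact hq
    exact (hl.good q).mixed p p' u v w hqp hqp' hup hup' hvp' hvp huw.symm (fun e => hvw e.symm)
      (hl.not_adj (by omega) (by omega))
  obtain ⟨t, hqt, ht⟩ := hl.parent q i hq
  exact h.binet (binet_isIndContained h.side p' u p q v w t hup'.symm hup.symm hqp.symm hqp'.symm
    hvp'.symm huw.symm hqt.symm (fun e => hvp e.symm) (hl.not_adj (by omega) (by omega))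
    (fun e => hvw e.symm) (hl.not_adj (by omega) (by omega)) (hl.not_adj (by omega) (by omega)))

end IsLayering

/-! ### Ordering the layers -/

/-- The number of neighbours in the next layer minus the number in the previous layer. -/
noncomputable def layerKey (G : SimpleGraph W) (d : W → ℕ) (v : W) : ℤ :=
  ({w | G.Adj v w ∧ d w = d v + 1}.ncard : ℤ) - {w | G.Adj v w ∧ d v = d w + 1}.ncard

/-- If one of the inclusions failed, `nested` and `not_mixed` would give both reverse inclusions,
one of them strict, and the keys would compare the other way. -/
theorem IsLayering.mono [Finite W] (hl : IsLayering G r d) (h : IsObstructionFree G s) {u v : W}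
    (e : r u = r v) (huv : d u = d v) (hkey : layerKey G d u ≤ layerKey G d v) :
    (∀ w, d w = d u + 1 → G.Adj u w → G.Adj v w) ∧
      ∀ w, d u = d w + 1 → G.Adj v w → G.Adj u w := by
  have key : ∀ A B A' B' : Set W, A ⊆ B → A' ⊆ B' → (A ⊂ B ∨ A' ⊂ B') →
      A.ncard + A'.ncard < B.ncard + B'.ncard := by
    intro A B A' B' h1 h2 h3
    have e1 := Set.ncard_le_ncard h1
    have e2 := Set.ncard_le_ncard h2
    rcases h3 with h3 | h3
    · have := Set.ncard_lt_ncard h3; omega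
    · have := Set.ncard_lt_ncard h3; omega
  by_contra hcon
  have hP : ∀ w, G.Adj u w → d u = d w + 1 → G.Adj v w := by
    intro p hup hp
    by_contra hvp
    apply hcon
    constructor
    · intro w hw huw
      by_contra hvw
      exact hl.not_mixed h huw hvw hup hvp huv hw hp e
    · intro p' hp' hvp'
      by_contra hup'
      exact hl.nested h (d p) u v p p' hup hup' hvp' hvp hp (by omega) rfl (by omega)
        (by rw [← hl.root_eq u p hup, ← hl.root_eq v p' hvp', e])
  have hN : ∀ w, G.Adj v w → d w = d u + 1 → G.Adj u w := by
    intro w' hvw' hw'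
    by_contra huw'
    apply hcon
    constructor
    · intro w hw huw
      by_contra hvw
      exact hl.nested h (d u) w w' u v huw.symm (fun e => hvw e.symm) hvw'.symm
        (fun e => huw' e.symm) hw hw' rfl huv.symm e
    · intro p hp hvp
      by_contra hup
      exact hl.not_mixed h hvw' huw' hvp hup huv.symm (by omega) (by omega) e.symm
  have := key {w | G.Adj v w ∧ d w = d v + 1} {w | G.Adj u w ∧ d w = d u + 1}
    {w | G.Adj u w ∧ d u = d w + 1} {w | G.Adj v w ∧ d v = d w + 1}
    (fun w hw => ⟨hN w hw.1 (by rw [huv]; exact hw.2), by rw [huv]; exact hw.2⟩)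
    (fun w hw => ⟨hP w hw.1 hw.2, by rw [← huv]; exact hw.2⟩) ?_
  · simp only [layerKey] at hkey
    omega
  · rw [not_and_or] at hcon
    push Not at hcon
    rcases hcon with ⟨w, hw, huw, hvw⟩ | ⟨w, hw, hvw, huw⟩
    · left
      refine ⟨fun w hw => ⟨hN w hw.1 (by rw [huv]; exact hw.2), by rw [huv]; exact hw.2⟩, ?_⟩
      exact fun hsub => hvw (hsub ⟨huw, hw⟩).1
    · right
      refine ⟨fun w hw => ⟨hP w hw.1 hw.2, by rw [← huv]; exact hw.2⟩, ?_⟩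
      exact fun hsub => huw (hsub ⟨hvw, huv ▸ hw⟩).1

theorem exists_bipartite_rank [Finite W] (h : IsObstructionFree G s) :
    ∃ ρ : W → ℕ ×ₗ ℕ ×ₗ ℤ,
      (∀ a b c e, s a = s b → G.Adj a c → G.Adj b e → ρ a < ρ b → ρ e < ρ c →
        G.Adj a e ∧ G.Adj b c) ∧
      ∀ a b, ρ a = ρ b → ∀ c, G.Adj a c ↔ G.Adj b c := by
  obtain ⟨r, d, hl⟩ := exists_isLayering h
  obtain ⟨κ, hκ⟩ : ∃ κ : W → ℕ, Function.Injective κ :=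
    ⟨fun v => Finite.equivFin W v, fun a b hab => (Finite.equivFin W).injective (Fin.ext hab)⟩
  have hpar : ∀ k v, d v = k → (s v = s (r v) ↔ k % 2 = 0) := by
    intro k
    induction k with
    | zero => intro v hv; rw [← hl.eq_root v hv]; simp
    | succ k ih =>
      intro v hv
      obtain ⟨u, hvu, hu⟩ := hl.parent v k hv
      have h1 := ih u hu
      rw [h.side _ _ hvu, hl.root_eq _ _ hvu]
      have h3 : (!s u) = s (r u) ↔ ¬ s u = s (r u) := by
        cases s u <;> cases s (r u) <;> simp
      rw [h3, h1]
      omega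
  refine ⟨fun v => toLex (κ (r v), toLex (d v, layerKey G d v)), ?_, ?_⟩
  · intro a b c e hab hac hbe hlt hlt'
    simp only [Prod.Lex.toLex_lt_toLex] at hlt hlt'
    have rac := hl.root_eq _ _ hac
    have rbe := hl.root_eq _ _ hbe
    rw [← rac, ← rbe] at hlt'
    have rab : r a = r b := hκ (by omega)
    have hp : d a % 2 = d b % 2 := by
      have h1 := hpar _ a rfl
      have h2 := hpar _ b rfl
      rw [hab, rab, h2] at h1
      omega
    have hlt : d a < d b ∨ d a = d b ∧ layerKey G d a < layerKey G d b := by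
      rw [rab] at hlt; simpa using hlt
    have hlt' : d e < d c ∨ d e = d c ∧ layerKey G d e < layerKey G d c := by
      rw [rab] at hlt'; simpa using hlt'
    have dac := hl.adj _ _ hac
    have dbe := hl.adj _ _ hbe
    have mab : d a = d b → _ := fun hd => hl.mono h rab hd (by omega)
    have mec : d e = d c → _ := fun hd => hl.mono h (by rw [← rbe, ← rab, rac] : r e = r c) hd
      (by omega)
    constructor
    -- When this fails, the order and parity of the layers force `c` and `e` into one layer, and
    -- these two are compared instead.
    · by_cases h1 : d a = d b ∧ d a = d e + 1
      · exact (mab h1.1).2 e h1.2 hbe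
      · exact ((mec (by omega)).2 a (by omega) hac.symm).symm
    · by_cases h1 : d a = d b ∧ d c = d a + 1
      · exact (mab h1.1).1 c h1.2 hac
      · exact ((mec (by omega)).1 b (by omega) hbe.symm).symm
  · intro a b hab c
    simp only [EmbeddingLike.apply_eq_iff_eq, Prod.mk.injEq] at hab
    obtain ⟨h1, h2, h3⟩ := hab
    have m1 := hl.mono h (hκ h1) h2 h3.le
    have m2 := hl.mono h (hκ h1).symm h2.symm h3.ge
    constructor
    · intro hac
      rcases hl.adj _ _ hac with hd | hd
      · exact m2.2 c (by omega) hac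
      · exact m1.1 c hd hac
    · intro hbc
      rcases hl.adj _ _ hbc with hd | hd
      · exact m1.2 c (by omega) hbc
      · exact m2.1 c hd hbc

end Bipartite

/-! ### Recognising the small obstructions of `H` and `S(H)` -/

section Digraph

variable {V : Type*} {H : Digraph V}

theorem containsInduced_of_twinFree {n : ℕ} {F : Digraph (Fin n)} (φ : Fin n → V)
    (hφ : ∀ i j, H.Adj (φ i) (φ j) ↔ F.Adj i j)
    (hF : ∀ i j, (∀ k, F.Adj i k ↔ F.Adj j k) → i = j) : ContainsInduced F H := by
  refine ⟨⟨⟨φ, fun i j hij => hF i j fun k => ?_⟩, fun {i j} => hφ i j⟩⟩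
  rw [← hφ, ← hφ, hij]

theorem containsInduced_H1 (hH : IsReflexive H) {a b c : V}
    (_ : H.Adj a b) (_ : H.Adj a c) (_ : H.Adj b a) (_ : H.Adj c b)
    (_ : ¬ H.Adj b c) (_ : ¬ H.Adj c a) :
    ContainsInduced H1 H := by
  refine containsInduced_of_twinFree ![a, b, c] ?_ (by unfold H1; decide)
  intro i j
  fin_cases i <;> fin_cases j <;> simp [H1, reflexiveOf] <;> first | assumption | exact hH _

theorem containsInduced_H2 (hH : IsReflexive H) {a b c d : V}
    (_ : H.Adj a b) (_ : H.Adj b c) (_ : H.Adj b d) (_ : H.Adj c b)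
    (_ : ¬ H.Adj a c) (_ : ¬ H.Adj a d) (_ : ¬ H.Adj b a) (_ : ¬ H.Adj c a) (_ : ¬ H.Adj c d)
    (_ : ¬ H.Adj d a) (_ : ¬ H.Adj d b) (_ : ¬ H.Adj d c) :
    ContainsInduced H2 H := by
  refine containsInduced_of_twinFree ![a, b, c, d] ?_ (by unfold H2; decide)
  intro i j
  fin_cases i <;> fin_cases j <;> simp [H2, reflexiveOf] <;> first | assumption | exact hH _

theorem containsInduced_H3 (hH : IsReflexive H) {a b c d : V}
    (_ : H.Adj a b) (_ : H.Adj a c) (_ : H.Adj b a) (_ : H.Adj b c)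
    (_ : H.Adj b d) (_ : H.Adj c b) (_ : ¬ H.Adj a d) (_ : ¬ H.Adj c a) (_ : ¬ H.Adj c d)
    (_ : ¬ H.Adj d a) (_ : ¬ H.Adj d b) (_ : ¬ H.Adj d c) :
    ContainsInduced H3 H := by
  refine containsInduced_of_twinFree ![a, b, c, d] ?_ (by unfold H3; decide)
  intro i j
  fin_cases i <;> fin_cases j <;> simp [H3, reflexiveOf] <;> first | assumption | exact hH _

theorem containsInduced_H4 (hH : IsReflexive H) {a b c d : V}
    (_ : H.Adj a b) (_ : H.Adj b a) (_ : H.Adj b d) (_ : H.Adj c a)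
    (_ : H.Adj c d) (_ : H.Adj d c) (_ : ¬ H.Adj a c) (_ : ¬ H.Adj a d) (_ : ¬ H.Adj b c)
    (_ : ¬ H.Adj c b) (_ : ¬ H.Adj d a) (_ : ¬ H.Adj d b) :
    ContainsInduced H4 H := by
  refine containsInduced_of_twinFree ![a, b, c, d] ?_ (by unfold H4; decide)
  intro i j
  fin_cases i <;> fin_cases j <;> simp [H4, reflexiveOf] <;> first | assumption | exact hH _

theorem containsInduced_H5 (hH : IsReflexive H) {a b c d : V}
    (_ : H.Adj a b) (_ : H.Adj a d) (_ : H.Adj b a) (_ : H.Adj b c)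
    (_ : H.Adj c a) (_ : H.Adj c b) (_ : H.Adj c d) (_ : ¬ H.Adj a c) (_ : ¬ H.Adj b d)
    (_ : ¬ H.Adj d a) (_ : ¬ H.Adj d b) (_ : ¬ H.Adj d c) :
    ContainsInduced H5 H := by
  refine containsInduced_of_twinFree ![a, b, c, d] ?_ (by unfold H5; decide)
  intro i j
  fin_cases i <;> fin_cases j <;> simp [H5, reflexiveOf] <;> first | assumption | exact hH _

theorem containsInduced_H6 (hH : IsReflexive H) {a b c d : V}
    (_ : H.Adj a b) (_ : H.Adj a d) (_ : H.Adj b a) (_ : H.Adj b c)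
    (_ : H.Adj c a) (_ : H.Adj c b) (_ : H.Adj c d) (_ : H.Adj d a) (_ : ¬ H.Adj a c)
    (_ : ¬ H.Adj b d) (_ : ¬ H.Adj d b) (_ : ¬ H.Adj d c) :
    ContainsInduced H6 H := by
  refine containsInduced_of_twinFree ![a, b, c, d] ?_ (by unfold H6; decide)
  intro i j
  fin_cases i <;> fin_cases j <;> simp [H6, reflexiveOf] <;> first | assumption | exact hH _

/-- Loops turn neighbourhoods into closed ones; where these are distinct, injectivity comes for
free. -/
theorem isIndContained_symGraph {n : ℕ} {F : SimpleGraph (Fin n)}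
    (φ : Fin n → V) (hφ : ∀ i j, (H.Adj (φ i) (φ j) ∧ H.Adj (φ j) (φ i)) ↔ i = j ∨ F.Adj i j)
    (hF : ∀ i j, (∀ k, (i = k ∨ F.Adj i k) ↔ (j = k ∨ F.Adj j k)) → i = j) : F ⊴ symGraph H := by
  have inj : Function.Injective φ := by
    intro i j hij
    refine hF i j fun k => ?_
    rw [← hφ, ← hφ, hij]
  refine ⟨⟨⟨φ, inj⟩, fun {i j} => ?_⟩⟩
  simp only [symGraph, Function.Embedding.coeFn_mk]
  rw [hφ, inj.ne_iff]
  constructor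
  · rintro ⟨h1, h2⟩
    exact h2.resolve_left h1
  · exact fun h => ⟨h.ne, Or.inr h⟩

theorem claw_isIndContained_symGraph (hH : IsReflexive H) {a b c d : V}
    (_ : H.Adj a b) (_ : H.Adj b a) (_ : H.Adj a c) (_ : H.Adj c a) (_ : H.Adj a d)
    (_ : H.Adj d a) (_ : ¬ H.Adj b c) (_ : ¬ H.Adj d b) (_ : ¬ H.Adj d c) :
    claw ⊴ symGraph H := by
  refine isIndContained_symGraph ![a, b, c, d] ?_ ?_
  · intro i j
    fin_cases i <;> fin_cases j <;> simp [claw, *, hH _]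
  · simp only [claw, SimpleGraph.fromEdgeSet_adj]
    decide

theorem square_isIndContained_symGraph (hH : IsReflexive H) {a b c d : V}
    (_ : H.Adj a b) (_ : H.Adj b a) (_ : H.Adj b c) (_ : H.Adj c b) (_ : H.Adj c d)
    (_ : H.Adj d c) (_ : H.Adj d a) (_ : H.Adj a d) (_ : ¬ H.Adj a c) (_ : ¬ H.Adj d b) :
    SimpleGraph.cycleGraph 4 ⊴ symGraph H := by
  refine isIndContained_symGraph ![a, b, c, d] ?_ ?_
  · have e : ∀ i j, (SimpleGraph.cycleGraph 4).Adj i j ↔ i - j = 1 ∨ j - i = 1 :=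
      fun _ _ => SimpleGraph.cycleGraph_adj
    intro i j
    rw [e]
    fin_cases i <;> fin_cases j <;> simp [*, hH _] <;> decide
  · simp only [SimpleGraph.cycleGraph_adj']
    decide

/-! ### Reconciling the tail order with the head order -/

variable {α : Type*} [LinearOrder α] {f g : V → α}

/-- `f` and `g` order the tails and the heads of the arcs of `H` without crossings, and their ties
are exactly the twins. -/
structure IsMinMaxPair (H : Digraph V) (f g : V → α) : Prop where
  cross : ∀ a b c e, H.Adj a c → H.Adj b e → f a < f b → g e < g c → H.Adj a e ∧ H.Adj b c
  tail : ∀ a b, f a = f b ↔ ∀ c, H.Adj a c ↔ H.Adj b c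
  head : ∀ a b, g a = g b ↔ ∀ c, H.Adj c a ↔ H.Adj c b

/-- `H` contains none of the digraphs and symmetric graphs on at most four vertices that obstruct
a Min-Max ordering. -/
structure IsLocallyFree (H : Digraph V) : Prop where
  h1 : ¬ ContainsInducedUpToConverse H1 H
  h2 : ¬ ContainsInducedUpToConverse H2 H
  h3 : ¬ ContainsInducedUpToConverse H3 H
  h4 : ¬ ContainsInducedUpToConverse H4 H
  h5 : ¬ ContainsInducedUpToConverse H5 H
  h6 : ¬ ContainsInducedUpToConverse H6 H
  claw : ¬ claw ⊴ symGraph H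
  square : ¬ SimpleGraph.cycleGraph 4 ⊴ symGraph H

theorem containsInduced_converse_iff {W : Type*} {F : Digraph W} :
    ContainsInduced (converse F) H ↔ ContainsInduced F (converse H) :=
  ⟨fun ⟨φ⟩ => ⟨⟨φ.toEmbedding, fun {a b} => φ.map_rel_iff (a := b) (b := a)⟩⟩,
    fun ⟨φ⟩ => ⟨⟨φ.toEmbedding, fun {a b} => φ.map_rel_iff (a := b) (b := a)⟩⟩⟩

namespace IsMinMaxPair

/-- Reversing both orders swaps the roles of `u` and `v`, which halves the case analysis in
`not_head_lt`. -/
theorem dual (hp : IsMinMaxPair H f g) :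
    IsMinMaxPair H (fun v => OrderDual.toDual (f v)) (fun v => OrderDual.toDual (g v)) where
  cross a b c e hac hbe hab hec := (hp.cross b a e c hbe hac hab hec).symm
  tail := hp.tail
  head := hp.head

theorem tail_lt (hp : IsMinMaxPair H f g) {a b : V} (h : ¬ f b < f a)
    (hne : ∃ c, ¬ (H.Adj a c ↔ H.Adj b c)) : f a < f b :=
  lt_of_le_of_ne (not_lt.1 h) fun e => hne.elim fun c hc => hc ((hp.tail a b).1 e c)

theorem head_lt (hp : IsMinMaxPair H f g) {a b : V} (h : ¬ g b < g a)
    (hne : ∃ c, ¬ (H.Adj c a ↔ H.Adj c b)) : g a < g b :=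
  lt_of_le_of_ne (not_lt.1 h) fun e => hne.elim fun c hc => hc ((hp.head a b).1 e c)

theorem head_lt_of_out (hp : IsMinMaxPair H f g) (hH : IsReflexive H) {u v y : V}
    (huv : f u < f v) (hvy : H.Adj v y) (huy : ¬ H.Adj u y) : g u < g y :=
  hp.head_lt (fun h => huy (hp.cross u v u y (hH u) hvy huv h).1) ⟨u, by simp [hH u, huy]⟩

theorem tail_lt_of_head_lt (hp : IsMinMaxPair H f g) (hH : IsReflexive H) {u y : V}
    (hgy : g u < g y) (huy : ¬ H.Adj u y) : f u < f y :=
  hp.tail_lt (fun h => huy (hp.cross y u y u (hH y) (hH u) h hgy).2) ⟨y, by simp [hH y, huy]⟩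

/-- Crossings place `y` and `z` and give `z → y`. Excluding `H1` makes `y` send arcs to both of `u`,
`v` or to neither, and `z` likewise receive them; the remaining choices give `H4`, `H5`, `H6`,
converses of the last two, or a four-cycle. -/
theorem false_of_out_in (hp : IsMinMaxPair H f g) (hH : IsReflexive H) (hl : IsLocallyFree H)
    {u v y z : V} (huv : f u < f v) (hvu : g v < g u)
    (hvy : H.Adj v y) (huy : ¬ H.Adj u y) (hzu : H.Adj z u) (hzv : ¬ H.Adj z v) : False := by
  have cross := hp.cross
  have auv := (cross u v u v (hH u) (hH v) huv hvu).1
  have avu := (cross u v u v (hH u) (hH v) huv hvu).2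
  have gy : g u < g y := hp.head_lt_of_out hH huv hvy huy
  have fy : f u < f y := hp.tail_lt_of_head_lt hH gy huy
  have fz : f v < f z := hp.tail_lt (fun h => hzv (cross z v u v hzu (hH v) h hvu).1)
    ⟨v, by simp [hH v, hzv]⟩
  have gz : g v < g z := hp.head_lt (fun h => hzv (cross v z v z (hH v) (hH z) fz h).2)
    ⟨z, by simp [hH z, hzv]⟩
  have azy : H.Adj z y := (cross v z y u hvy hzu fz gy).2
  have y1 : H.Adj y v → H.Adj y u := fun h => (cross u y u v (hH u) h fy hvu).2
  have z1 : H.Adj u z → H.Adj v z := fun h => (cross u v z v h (hH v) huv gz).2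
  have y2 : H.Adj y u → H.Adj y v := fun h => by
    by_contra hyv
    exact hl.h1 (Or.inl (containsInduced_H1 (a := v) (b := u) (c := y) hH ‹_› ‹_› ‹_› ‹_› ‹_› ‹_›))
  have z2 : H.Adj v z → H.Adj u z := fun h => by
    by_contra huz
    exact hl.h1 (Or.inl (containsInduced_H1 (a := v) (b := u) (c := z) hH ‹_› ‹_› ‹_› ‹_› ‹_› ‹_›))
  by_cases ay : H.Adj y u
  · have ay' := y2 ay
    by_cases az : H.Adj u z
    · have az' := z1 az
      have f1 : f y < f z := hp.tail_lt (fun h => hzv (cross z y u v hzu ay' h hvu).1)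
        ⟨v, by simp [ay', hzv]⟩
      have g1 : g z < g y := hp.head_lt (fun h => huy (cross u v z y az hvy huv h).1)
        ⟨u, by simp [az, huy]⟩
      have ayz := (cross y z y z (hH y) (hH z) f1 g1).1
      exact hl.square (square_isIndContained_symGraph hH auv avu hvy ay' ayz azy hzu az huy hzv)
    · have az' : ¬ H.Adj v z := fun h => az (z2 h)
      by_cases ayz : H.Adj y z
      · exact hl.h6 (Or.inr (containsInduced_converse_iff.2 (containsInduced_H6 (H := converse H)
          (a := y) (b := v) (c := u) (d := z) hH ‹_› ‹_› ‹_› ‹_› ‹_› ‹_› ‹_› ‹_› ‹_› ‹_› ‹_› ‹_›)))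
      · exact hl.h5 (Or.inr (containsInduced_converse_iff.2 (containsInduced_H5 (H := converse H)
          (a := y) (b := v) (c := u) (d := z) hH ‹_› ‹_› ‹_› ‹_› ‹_› ‹_› ‹_› ‹_› ‹_› ‹_› ‹_› ‹_›)))
  · have ay' : ¬ H.Adj y v := fun h => ay (y1 h)
    by_cases az : H.Adj u z
    · have az' := z1 az
      by_cases ayz : H.Adj y z
      · exact hl.h6 (Or.inl (containsInduced_H6 (a := z) (b := u) (c := v) (d := y) hH
          ‹_› ‹_› ‹_› ‹_› ‹_› ‹_› ‹_› ‹_› ‹_› ‹_› ‹_› ‹_›))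
      · exact hl.h5 (Or.inl (containsInduced_H5 (a := z) (b := u) (c := v) (d := y) hH
          ‹_› ‹_› ‹_› ‹_› ‹_› ‹_› ‹_› ‹_› ‹_› ‹_› ‹_› ‹_›))
    · have az' : ¬ H.Adj v z := fun h => az (z2 h)
      have f1 : f z < f y := hp.tail_lt (fun h => ay (cross y z y u (hH y) hzu h gy).1)
        ⟨u, by simp [hzu, ay]⟩
      have ayz : H.Adj y z := by
        by_contra ayz
        have g1 : g z < g y := hp.head_lt (fun h => ayz (cross z y z y (hH z) (hH y) f1 h).2)
          ⟨y, by simp [hH y, ayz]⟩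
        exact az' (cross v z y z hvy (hH z) fz g1).1
      exact hl.h4 (Or.inl (containsInduced_H4 (a := u) (b := v) (c := z) (d := y) hH
        ‹_› ‹_› ‹_› ‹_› ‹_› ‹_› ‹_› ‹_› ‹_› ‹_› ‹_› ‹_›))

/-- As in the previous case, but now there is no arc `z → y`, and the outcomes are a claw, `H2`,
`H3` or its converse. -/
theorem false_of_out_out (hp : IsMinMaxPair H f g) (hH : IsReflexive H) (hl : IsLocallyFree H)
    {u v y z : V} (huv : f u < f v) (hvu : g v < g u)
    (hvy : H.Adj v y) (huy : ¬ H.Adj u y) (hzv : H.Adj z v) (hzu : ¬ H.Adj z u) : False := by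
  have cross := hp.cross
  have auv := (cross u v u v (hH u) (hH v) huv hvu).1
  have avu := (cross u v u v (hH u) (hH v) huv hvu).2
  have gy : g u < g y := hp.head_lt_of_out hH huv hvy huy
  have fy : f u < f y := hp.tail_lt_of_head_lt hH gy huy
  have fz : f z < f u := hp.tail_lt (fun h => hzu (cross u z u v (hH u) hzv h hvu).2)
    ⟨u, by simp [hH u, hzu]⟩
  have gz : g z < g u := hp.head_lt (fun h => hzu (cross z u z u (hH z) (hH u) fz h).1)
    ⟨z, by simp [hH z, hzu]⟩
  have azy : ¬ H.Adj z y := fun h => hzu (cross z u y u h (hH u) fz gy).1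
  have y1 : H.Adj y v → H.Adj y u := fun h => (cross u y u v (hH u) h fy hvu).2
  have z1 : H.Adj v z → H.Adj u z := fun h => (cross u v u z (hH u) h huv gz).1
  have yz1 : H.Adj y z → H.Adj u z ∧ H.Adj y u := fun h => cross u y u z (hH u) h fy gz
  have y2 : H.Adj y u → H.Adj y v := fun h => by
    by_contra hyv
    exact hl.h1 (Or.inl (containsInduced_H1 (a := v) (b := u) (c := y) hH ‹_› ‹_› ‹_› ‹_› ‹_› ‹_›))
  have z2 : H.Adj u z → H.Adj v z := fun h => by
    by_contra hvz
    exact hl.h1 (Or.inl (containsInduced_H1 (a := u) (b := v) (c := z) hH ‹_› ‹_› ‹_› ‹_› ‹_› ‹_›))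
  by_cases ay : H.Adj y u
  · have ay' := y2 ay
    by_cases az : H.Adj u z
    · have az' := z2 az
      exact hl.claw (claw_isIndContained_symGraph hH avu auv hvy ay' az' hzv huy hzu azy)
    · have az' : ¬ H.Adj v z := fun h => az (z1 h)
      have ayz : ¬ H.Adj y z := fun h => az (yz1 h).1
      exact hl.h3 (Or.inr (containsInduced_converse_iff.2 (containsInduced_H3 (H := converse H)
        (a := u) (b := v) (c := y) (d := z) hH ‹_› ‹_› ‹_› ‹_› ‹_› ‹_› ‹_› ‹_› ‹_› ‹_› ‹_› ‹_›)))
  · have ay' : ¬ H.Adj y v := fun h => ay (y1 h)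
    have ayz : ¬ H.Adj y z := fun h => ay (yz1 h).2
    by_cases az : H.Adj u z
    · have az' := z2 az
      exact hl.h3 (Or.inl (containsInduced_H3 (a := u) (b := v) (c := z) (d := y) hH
        ‹_› ‹_› ‹_› ‹_› ‹_› ‹_› ‹_› ‹_› ‹_› ‹_› ‹_› ‹_›))
    · have az' : ¬ H.Adj v z := fun h => az (z1 h)
      exact hl.h2 (Or.inl (containsInduced_H2 (a := z) (b := v) (c := u) (d := y) hH
        ‹_› ‹_› ‹_› ‹_› ‹_› ‹_› ‹_› ‹_› ‹_› ‹_› ‹_› ‹_›))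

theorem not_head_lt (hp : IsMinMaxPair H f g) (hH : IsReflexive H) (hl : IsLocallyFree H)
    {u v : V} (huv : f u < f v) : ¬ g v < g u := by
  intro hvu
  have h1 : ¬ ∀ y, H.Adj u y ↔ H.Adj v y := fun h => huv.ne ((hp.tail u v).2 h)
  have h2 : ¬ ∀ z, H.Adj z v ↔ H.Adj z u := fun h => hvu.ne ((hp.head v u).2 h)
  push Not at h1 h2
  obtain ⟨y, ⟨huy, hvy⟩ | ⟨huy, hvy⟩⟩ := h1 <;> obtain ⟨z, ⟨hzv, hzu⟩ | ⟨hzv, hzu⟩⟩ := h2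
  · exact hp.dual.false_of_out_in hH hl huv hvu huy hvy hzv hzu
  · exact hp.dual.false_of_out_out hH hl huv hvu huy hvy hzu hzv
  · exact hp.false_of_out_out hH hl huv hvu hvy huy hzv hzu
  · exact hp.false_of_out_in hH hl huv hvu hvy huy hzu hzv

theorem hasMinMaxOrdering [Finite V] (hp : IsMinMaxPair H f g) (hH : IsReflexive H)
    (hl : IsLocallyFree H) : HasMinMaxOrdering H := by
  -- The last coordinate only separates vertices that are twins both as tails and as heads.
  let key : V → α ×ₗ α ×ₗ Fin (Nat.card V) :=
    fun v => toLex (f v, toLex (g v, Finite.equivFin V v))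
  have hkey : Function.Injective key := by
    intro a b hab
    simp only [key, EmbeddingLike.apply_eq_iff_eq, Prod.mk.injEq] at hab
    exact hab.2.2
  refine ⟨LinearOrder.lift' key hkey, ?_⟩
  intro i j t r hij htr hir hjt
  have hij : f i < f j ∨ f i = f j := by
    have : key i < key j := hij
    simp only [key, Prod.Lex.toLex_lt_toLex] at this
    exact this.imp id And.left
  have htr : f t < f r ∨ f t = f r ∧ g t ≤ g r := by
    have : key t < key r := htr
    simp only [key, Prod.Lex.toLex_lt_toLex] at this
    refine this.imp id fun h => ⟨h.1, h.2.elim le_of_lt fun h => h.1.le⟩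
  rcases hij with hij | hij
  · have hg : g t ≤ g r := htr.elim (fun h => not_lt.1 (hp.not_head_lt hH hl h)) And.right
    rcases hg.lt_or_eq with hg | hg
    · exact hp.cross i j r t hir hjt hij hg
    · have := (hp.head t r).1 hg
      exact ⟨(this i).2 hir, (this j).1 hjt⟩
  · have := (hp.tail i j).1 hij
    exact ⟨(this t).2 hjt, (this r).1 hir⟩

end IsMinMaxPair

/-! ### From `B(H)` to a pair of orders -/

/-- Twins may be ranked apart, for instance in different layers; giving each the rank of a lowest
twin makes ties and twins coincide. -/
theorem exists_rank_of_twins [Finite V] {β : Type*} (N : V → β) (ρ : V → α)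
    (hρ : ∀ a b, ρ a = ρ b → N a = N b) :
    ∃ m : V → V, (∀ a, N (m a) = N a) ∧ ∀ a b, ρ (m a) = ρ (m b) ↔ N a = N b := by
  have h : ∀ a, ∃ b, N b = N a ∧ ∀ c, N c = N a → ρ b ≤ ρ c := by
    intro a
    have : Nonempty {c // N c = N a} := ⟨⟨a, rfl⟩⟩
    obtain ⟨b, hb⟩ := Finite.exists_min (fun c : {c // N c = N a} => ρ c)
    exact ⟨b, b.2, fun c hc => hb ⟨c, hc⟩⟩
  choose m h1 h2 using h
  refine ⟨m, h1, fun a b => ⟨fun e => ?_, fun e => ?_⟩⟩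
  · rw [← h1 a, ← h1 b, hρ _ _ e]
  · exact le_antisymm (h2 a _ ((h1 b).trans e.symm)) (h2 b _ ((h1 a).trans e))

theorem hasMinMaxOrdering_of_isObstructionFree [Finite V] (hH : IsReflexive H)
    (hl : IsLocallyFree H) (hb : IsObstructionFree (bipGraph H) Sum.isLeft) :
    HasMinMaxOrdering H := by
  obtain ⟨ρ, hcross, htie⟩ := exists_bipartite_rank hb
  obtain ⟨m, hm, hmt⟩ := exists_rank_of_twins (fun v w => H.Adj v w) (fun v => ρ (Sum.inl v))
    fun a b e => funext fun c => propext (htie _ _ e (Sum.inr c))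
  obtain ⟨n, hn, hnt⟩ := exists_rank_of_twins (fun v w => H.Adj w v) (fun v => ρ (Sum.inr v))
    fun a b e => funext fun c => propext (htie _ _ e (Sum.inl c))
  have hm' : ∀ a c, H.Adj (m a) c ↔ H.Adj a c := fun a c => iff_of_eq (congrFun (hm a) c)
  have hn' : ∀ a c, H.Adj c (n a) ↔ H.Adj c a := fun a c => iff_of_eq (congrFun (hn a) c)
  refine IsMinMaxPair.hasMinMaxOrdering (f := fun v => ρ (Sum.inl (m v)))
    (g := fun v => ρ (Sum.inr (n v))) ⟨?_, ?_, ?_⟩ hH hl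
  · intro a b c e hac hbe hab hec
    have := hcross (Sum.inl (m a)) (Sum.inl (m b)) (Sum.inr (n c)) (Sum.inr (n e)) rfl
      ((hm' _ _).2 ((hn' _ _).2 hac)) ((hm' _ _).2 ((hn' _ _).2 hbe)) hab hec
    exact ⟨(hm' _ _).1 ((hn' _ _).1 this.1), (hm' _ _).1 ((hn' _ _).1 this.2)⟩
  · intro a b
    simp only [hmt, funext_iff, eq_iff_iff]
  · intro a b
    simp only [hnt, funext_iff, eq_iff_iff]


/-! ### Necessity: forced comparisons -/

theorem IsMinMaxOrdering.lt_iff {o : LinearOrder V} (ho : IsMinMaxOrdering H o) (a b c e : V)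
    (h : H.Adj a c ∧ H.Adj b e ∧ ¬ (H.Adj a e ∧ H.Adj b c)) : o.lt a b ↔ o.lt c e := by
  obtain ⟨hac, hbe, hn⟩ := h
  constructor
  · intro hab
    rcases lt_trichotomy c e with hce | hce | hce
    · exact hce
    · subst hce; exact absurd ⟨hac, hbe⟩ hn
    · exact absurd (ho a b e c hab hce hac hbe) hn
  · intro hce
    rcases lt_trichotomy a b with hab | hab | hab
    · exact hab
    · subst hab; exact absurd ⟨hbe, hac⟩ hn
    · exact absurd (ho b a c e hab hce hbe hac).symm hn

theorem not_lt_iff_lt_swap (o : LinearOrder V) {a b : V} (hab : a ≠ b) :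
    ¬ (o.lt a b ↔ o.lt b a) := by
  intro h
  rcases lt_or_gt_of_ne hab with h1 | h1
  · exact lt_asymm h1 (h.1 h1)
  · exact lt_asymm h1 (h.2 h1)

theorem HasMinMaxOrdering.of_containsInduced {W : Type*} {F : Digraph W}
    (h : HasMinMaxOrdering H) (hF : ContainsInduced F H) : HasMinMaxOrdering F := by
  obtain ⟨o, ho⟩ := h
  obtain ⟨φ⟩ := hF
  refine ⟨LinearOrder.lift' φ φ.injective, fun i j t r hij htr hir hjt => ?_⟩
  have := ho (φ i) (φ j) (φ t) (φ r) hij htr (φ.map_rel_iff.2 hir) (φ.map_rel_iff.2 hjt)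
  exact ⟨φ.map_rel_iff.1 this.1, φ.map_rel_iff.1 this.2⟩

theorem IsMinMaxOrdering.converse {o : LinearOrder V} (ho : IsMinMaxOrdering H o) :
    IsMinMaxOrdering (converse H) o :=
  fun i j t r hij htr hir hjt => ho t r i j htr hij hjt hir

theorem HasMinMaxOrdering.converse (h : HasMinMaxOrdering H) :
    HasMinMaxOrdering (converse H) := by
  obtain ⟨o, ho⟩ := h
  exact ⟨o, ho.converse⟩

theorem HasMinMaxOrdering.not_containsInducedUpToConverse {W : Type*} {F : Digraph W}
    (h : HasMinMaxOrdering H) (hF : ¬ HasMinMaxOrdering F) :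
    ¬ ContainsInducedUpToConverse F H := by
  rintro (h' | h')
  · exact hF (h.of_containsInduced h')
  · exact hF (h.converse.of_containsInduced (containsInduced_converse_iff.1 h'))

/-- Forced equivalences lead from `0 < 1` to `1 < 0`; each link is a finite check. The other fixed
patterns are refuted in the same way. -/
theorem not_hasMinMaxOrdering_H1 : ¬ HasMinMaxOrdering H1 := by
  rintro ⟨o, ho⟩
  have st := ho.lt_iff
  unfold H1 at st
  exact not_lt_iff_lt_swap o (by decide : (0 : Fin 3) ≠ 1) <|
    (st 0 2 0 1 (by decide)).symm.trans <|
    (st 1 0 0 2 (by decide)).symm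

theorem not_hasMinMaxOrdering_H2 : ¬ HasMinMaxOrdering H2 := by
  rintro ⟨o, ho⟩
  have st := ho.lt_iff
  unfold H2 at st
  exact not_lt_iff_lt_swap o (by decide : (0 : Fin 4) ≠ 1) <|
    (st 0 1 1 2 (by decide)).trans <|
    (st 1 2 3 1 (by decide)).trans <|
    (st 1 0 3 1 (by decide)).symm

theorem not_hasMinMaxOrdering_H3 : ¬ HasMinMaxOrdering H3 := by
  rintro ⟨o, ho⟩
  have st := ho.lt_iff
  unfold H3 at st
  exact not_lt_iff_lt_swap o (by decide : (0 : Fin 4) ≠ 1) <|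
    (st 1 2 0 1 (by decide)).symm.trans <|
    (st 1 2 3 1 (by decide)).trans <|
    (st 1 0 3 1 (by decide)).symm

theorem not_hasMinMaxOrdering_H4 : ¬ HasMinMaxOrdering H4 := by
  rintro ⟨o, ho⟩
  have st := ho.lt_iff
  unfold H4 at st
  exact not_lt_iff_lt_swap o (by decide : (0 : Fin 4) ≠ 1) <|
    (st 0 1 0 3 (by decide)).trans <|
    (st 0 3 0 2 (by decide)).trans <|
    (st 0 2 1 0 (by decide))

theorem not_hasMinMaxOrdering_H5 : ¬ HasMinMaxOrdering H5 := by
  rintro ⟨o, ho⟩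
  have st := ho.lt_iff
  unfold H5 at st
  exact not_lt_iff_lt_swap o (by decide : (0 : Fin 4) ≠ 1) <|
    (st 0 1 1 2 (by decide)).trans <|
    (st 1 2 0 3 (by decide)).trans <|
    (st 1 0 0 3 (by decide)).symm

theorem not_hasMinMaxOrdering_H6 : ¬ HasMinMaxOrdering H6 := by
  rintro ⟨o, ho⟩
  have st := ho.lt_iff
  unfold H6 at st
  exact not_lt_iff_lt_swap o (by decide : (0 : Fin 4) ≠ 1) <|
    (st 0 1 1 2 (by decide)).trans <|
    (st 1 2 0 3 (by decide)).trans <|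
    (st 0 3 1 0 (by decide))

/-- A graph with a loop added at each vertex, as a digraph. -/
def loopedDigraph {W : Type*} (F : SimpleGraph W) : Digraph W where
  Adj a b := a = b ∨ F.Adj a b

theorem HasMinMaxOrdering.loopedDigraph_of_isIndContained (hH : IsReflexive H) {W : Type*}
    {F : SimpleGraph W} (h : HasMinMaxOrdering H) (hF : F ⊴ symGraph H) :
    HasMinMaxOrdering (loopedDigraph F) := by
  obtain ⟨o, ho⟩ := h
  obtain ⟨φ⟩ := hF
  have hφ : ∀ i j, (loopedDigraph F).Adj i j ↔ H.Adj (φ i) (φ j) ∧ H.Adj (φ j) (φ i) := by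
    intro i j
    have h1 : (φ i ≠ φ j ∧ H.Adj (φ i) (φ j) ∧ H.Adj (φ j) (φ i)) ↔ F.Adj i j :=
      φ.map_rel_iff (a := i) (b := j)
    simp only [loopedDigraph, ← h1]
    by_cases hij : i = j
    · subst hij; simp [hH (φ i)]
    · simp [hij, φ.injective.ne_iff]
  refine ⟨LinearOrder.lift' φ φ.injective, fun i j t r hij htr hir hjt => ?_⟩
  rw [hφ] at hir hjt ⊢
  rw [hφ]
  have h1 := ho (φ i) (φ j) (φ t) (φ r) hij htr hir.1 hjt.1
  -- Exchanging the two pairs applies the ordering to the reversed arcs.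
  have h2 := ho (φ t) (φ r) (φ i) (φ j) htr hij hjt.2 hir.2
  exact ⟨⟨h1.1, h2.1⟩, h1.2, h2.2⟩

theorem not_hasMinMaxOrdering_claw : ¬ HasMinMaxOrdering (loopedDigraph claw) := by
  rintro ⟨o, ho⟩
  have st := ho.lt_iff
  simp only [loopedDigraph, claw, SimpleGraph.fromEdgeSet_adj] at st
  exact not_lt_iff_lt_swap o (by decide : (0 : Fin 4) ≠ 1) <|
    (st 0 1 2 0 (by decide)).trans <|
    (st 2 0 0 3 (by decide)).trans <|
    (st 0 3 1 0 (by decide))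

theorem not_hasMinMaxOrdering_net : ¬ HasMinMaxOrdering (loopedDigraph net) := by
  rintro ⟨o, ho⟩
  have st := ho.lt_iff
  simp only [loopedDigraph, net, SimpleGraph.fromEdgeSet_adj] at st
  exact not_lt_iff_lt_swap o (by decide : (0 : Fin 6) ≠ 1) <|
    (st 0 1 0 4 (by decide)).trans <|
    (st 0 4 2 1 (by decide)).trans <|
    (st 2 1 5 0 (by decide)).trans <|
    (st 5 0 2 3 (by decide)).trans <|
    (st 2 3 1 0 (by decide))

set_option synthInstance.maxSize 1000 in
set_option synthInstance.maxHeartbeats 200000 in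
theorem not_hasMinMaxOrdering_tent : ¬ HasMinMaxOrdering (loopedDigraph tent) := by
  rintro ⟨o, ho⟩
  have st := ho.lt_iff
  simp only [loopedDigraph, tent, SimpleGraph.fromEdgeSet_adj] at st
  exact not_lt_iff_lt_swap o (by decide : (0 : Fin 6) ≠ 4) <|
    (st 0 4 3 2 (by decide)).trans <|
    (st 3 2 1 5 (by decide)).trans <|
    (st 1 5 4 0 (by decide))

theorem exists_lt_of_ne [Finite V] [Nonempty V] (o : LinearOrder V) :
    ∃ v, ∀ w, v ≠ w → o.lt v w := by
  obtain ⟨v, hv⟩ := Finite.exists_min (id : V → V)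
  exact ⟨v, fun w hw => lt_of_le_of_ne (hv w) hw⟩

/-- The loop at the smaller neighbour of a minimal vertex forces its two neighbours to be adjacent.
-/
theorem not_hasMinMaxOrdering_cycleGraph {k : ℕ} (hk : 4 ≤ k) :
    ¬ HasMinMaxOrdering (loopedDigraph (SimpleGraph.cycleGraph k)) := by
  obtain ⟨m, rfl⟩ : ∃ m, k = m + 4 := ⟨k - 4, by omega⟩
  rintro ⟨o, ho⟩
  obtain ⟨v, hmin⟩ := exists_lt_of_ne o
  have key : ∀ a b, (SimpleGraph.cycleGraph (m + 4)).Adj v a →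
      (SimpleGraph.cycleGraph (m + 4)).Adj v b → o.lt a b →
      (SimpleGraph.cycleGraph (m + 4)).Adj a b := by
    intro a b ha hb hab
    exact (ho v a a b (hmin a ha.ne) hab (Or.inr hb) (Or.inl rfl)).2.resolve_left
      (by rintro rfl; exact @lt_irrefl _ o.toPreorder _ hab)
  have h1 : (SimpleGraph.cycleGraph (m + 4)).Adj v (v + 1) :=
    SimpleGraph.cycleGraph_adj.2 (Or.inr (by abel))
  have h2 : (SimpleGraph.cycleGraph (m + 4)).Adj v (v - 1) :=
    SimpleGraph.cycleGraph_adj.2 (Or.inl (by abel))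
  have e1 : (1 : Fin (m + 4)) ≠ 0 := by simp
  have e2 : (1 + 1 : Fin (m + 4)) ≠ 0 := by
    simp only [ne_eq, Fin.ext_iff, Fin.val_add, Fin.val_one, Fin.val_zero]
    rw [Nat.mod_eq_of_lt (by omega)]
    omega
  have e3 : (1 + 1 + 1 : Fin (m + 4)) ≠ 0 := by
    simp only [ne_eq, Fin.ext_iff, Fin.val_add, Fin.val_one, Fin.val_zero]
    rw [Nat.mod_add_mod, Nat.mod_eq_of_lt (by omega)]
    omega
  have hn : ¬ (SimpleGraph.cycleGraph (m + 4)).Adj (v + 1) (v - 1) := by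
    rw [SimpleGraph.cycleGraph_adj]
    rintro (h | h)
    · exact e1 (by rw [← sub_eq_zero] at h; rw [← h]; abel)
    · exact e3 (by rw [← sub_eq_zero] at h; rw [← neg_eq_zero, ← h]; abel)
  rcases @lt_trichotomy _ o (v + 1) (v - 1) with h | h | h
  · exact hn (key _ _ h1 h2 h)
  · refine e2 ?_
    rw [← sub_eq_zero] at h
    rw [← h]
    abel
  · exact hn (key _ _ h2 h1 h).symm

/-! ### Necessity: obstructions in `B(H)` -/

/-- The vertex of `H` underlying a vertex of `B(H)`. -/
def base : V ⊕ V → V := Sum.elim id id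

/-- `x` and `y` are on the same side of `B(H)`, with `x` below `y`. -/
def SideLT (o : LinearOrder V) (x y : V ⊕ V) : Prop :=
  x.isLeft = y.isLeft ∧ o.lt (base x) (base y)

theorem bipGraph_isLeft {x y : V ⊕ V} (h : (bipGraph H).Adj x y) : x.isLeft = !y.isLeft := by
  rcases x with x | x <;> rcases y with y | y <;> first | rfl | exact h.elim

theorem SideLT.or_of_ne (o : LinearOrder V) {x y : V ⊕ V} (h : x.isLeft = y.isLeft) (hxy : x ≠ y) :
    SideLT o x y ∨ SideLT o y x := by
  have : base x ≠ base y := by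
    rcases x with x | x <;> rcases y with y | y <;> simp_all [base]
  exact (lt_or_gt_of_ne this).imp (fun h' => ⟨h, h'⟩) fun h' => ⟨h.symm, h'⟩

theorem SideLT.asymm {o : LinearOrder V} {x y : V ⊕ V} (h : SideLT o x y) : ¬ SideLT o y x :=
  fun h' => lt_asymm h.2 h'.2

theorem SideLT.step {o : LinearOrder V} (ho : IsMinMaxOrdering H o) {x y z w : V ⊕ V}
    (hxz : (bipGraph H).Adj x z) (hyw : (bipGraph H).Adj y w)
    (hn : ¬ ((bipGraph H).Adj x w ∧ (bipGraph H).Adj y z)) (h : SideLT o x y) :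
    SideLT o z w := by
  have h1 := bipGraph_isLeft hxz.symm
  have h2 := bipGraph_isLeft hyw.symm
  refine ⟨by rw [h1, h2, h.1], ?_⟩
  have h3 := h.1
  have h4 := h.2
  rcases x with x | x <;> rcases y with y | y <;> rcases z with z | z <;> rcases w with w | w <;>
    first
    | (exfalso; simp at h1; done)
    | (exfalso; simp at h2; done)
    | (exfalso; simp at h3; done)
    | exact (ho.lt_iff x y z w ⟨hxz, hyw, hn⟩).1 h4
    | exact (ho.converse.lt_iff x y z w ⟨hxz, hyw, hn⟩).1 h4

/-- The abstract relation `P` stands for `SideLT`, so that a chain of forced comparisons can be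
checked on the pattern alone. The common neighbour `x` puts `a` and `b` on one side. -/
theorem false_of_isIndContained_bipGraph {n : ℕ} {F : SimpleGraph (Fin n)}
    (h : HasMinMaxOrdering H) (hF : F ⊴ bipGraph H) (a b x : Fin n)
    (hab : a ≠ b) (hax : F.Adj a x) (hbx : F.Adj b x)
    (inv : ∀ P : Fin n → Fin n → Prop,
      (∀ i j k l, (F.Adj i k ∧ F.Adj j l ∧ ¬ (F.Adj i l ∧ F.Adj j k)) → (P i j ↔ P k l)) →
      (P a b ↔ P b a)) : False := by
  obtain ⟨o, ho⟩ := h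
  obtain ⟨φ⟩ := hF
  have hφ : ∀ i j, (bipGraph H).Adj (φ i) (φ j) ↔ F.Adj i j := fun i j => φ.map_rel_iff
  have := inv (fun i j => SideLT o (φ i) (φ j)) fun i j k l hs => by
    rw [← hφ, ← hφ, ← hφ, ← hφ] at hs
    exact ⟨.step ho hs.1 hs.2.1 hs.2.2,
      .step ho hs.1.symm hs.2.1.symm fun h => hs.2.2 ⟨h.2.symm, h.1.symm⟩⟩
  have hside : (φ a).isLeft = (φ b).isLeft := by
    rw [bipGraph_isLeft ((hφ _ _).2 hax), bipGraph_isLeft ((hφ _ _).2 hbx)]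
  rcases SideLT.or_of_ne o hside (φ.injective.ne hab) with h1 | h1
  · exact h1.asymm (this.1 h1)
  · exact h1.asymm (this.2 h1)

theorem HasMinMaxOrdering.not_biclaw (h : HasMinMaxOrdering H) : ¬ biclaw ⊴ bipGraph H := by
  intro hF
  refine false_of_isIndContained_bipGraph h hF 0 4 1 (by decide)
    (by simp only [biclaw, SimpleGraph.fromEdgeSet_adj]; decide)
    (by simp only [biclaw, SimpleGraph.fromEdgeSet_adj]; decide) fun P st => ?_
  simp only [biclaw, SimpleGraph.fromEdgeSet_adj] at st
  exact
    (st 0 4 2 1 (by decide)).trans <|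
    (st 2 1 5 0 (by decide)).trans <|
    (st 5 0 2 3 (by decide)).trans <|
    (st 2 3 0 6 (by decide)).trans <|
    (st 0 6 1 3 (by decide)).trans <|
    (st 1 3 4 0 (by decide))

theorem HasMinMaxOrdering.not_binet (h : HasMinMaxOrdering H) : ¬ binet ⊴ bipGraph H := by
  intro hF
  refine false_of_isIndContained_bipGraph h hF 0 2 1 (by decide)
    (by simp only [binet, SimpleGraph.fromEdgeSet_adj]; decide)
    (by simp only [binet, SimpleGraph.fromEdgeSet_adj]; decide) fun P st => ?_
  simp only [binet, SimpleGraph.fromEdgeSet_adj] at st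
  exact
    (st 0 2 4 1 (by decide)).trans <|
    (st 4 1 0 5 (by decide)).trans <|
    (st 0 5 3 1 (by decide)).trans <|
    (st 3 1 6 0 (by decide)).trans <|
    (st 6 0 3 4 (by decide)).trans <|
    (st 3 4 2 0 (by decide))

theorem HasMinMaxOrdering.not_bitent (h : HasMinMaxOrdering H) : ¬ bitent ⊴ bipGraph H := by
  intro hF
  refine false_of_isIndContained_bipGraph h hF 0 2 1 (by decide)
    (by simp only [bitent, SimpleGraph.fromEdgeSet_adj]; decide)
    (by simp only [bitent, SimpleGraph.fromEdgeSet_adj]; decide) fun P st => ?_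
  simp only [bitent, SimpleGraph.fromEdgeSet_adj] at st
  exact
    (st 0 2 5 3 (by decide)).trans <|
    (st 5 3 4 0 (by decide)).trans <|
    (st 4 0 1 6 (by decide)).trans <|
    (st 1 6 2 0 (by decide))

theorem HasMinMaxOrdering.not_cycleGraph (h : HasMinMaxOrdering H) {k : ℕ} (hk : 3 ≤ k) :
    ¬ SimpleGraph.cycleGraph (2 * k) ⊴ bipGraph H := by
  obtain ⟨m, hm⟩ : ∃ m, 2 * k = m + 6 := ⟨2 * k - 6, by omega⟩
  rw [hm]
  rintro ⟨φ⟩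
  obtain ⟨o, ho⟩ := h
  have hφ : ∀ i j, (SimpleGraph.cycleGraph (m + 6)).Adj i j → (bipGraph H).Adj (φ i) (φ j) :=
    fun i j => φ.map_rel_iff.2
  have hφ' : ∀ i j, ¬ (SimpleGraph.cycleGraph (m + 6)).Adj i j → ¬ (bipGraph H).Adj (φ i) (φ j) :=
    fun i j h h' => h (φ.map_rel_iff.1 h')
  have hsucc : ∀ i, (SimpleGraph.cycleGraph (m + 6)).Adj i (i + 1) :=
    fun i => SimpleGraph.cycleGraph_adj.2 (Or.inr (by abel))
  have hpred : ∀ i, (SimpleGraph.cycleGraph (m + 6)).Adj i (i - 1) :=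
    fun i => SimpleGraph.cycleGraph_adj.2 (Or.inl (by abel))
  have : Nonempty {i // (φ i).isLeft = true} := by
    have h01 := bipGraph_isLeft (hφ 0 (0 + 1) (hsucc 0))
    by_cases h0 : (φ 0).isLeft = true
    · exact ⟨⟨0, h0⟩⟩
    · exact ⟨⟨0 + 1, by simpa [h0] using h01.symm⟩⟩
  obtain ⟨⟨i, hi⟩, hmin⟩ :=
    @Finite.exists_min _ V _ _ o fun i : {i // (φ i).isLeft = true} => base (φ i)
  -- With `i` minimal among the white vertices, the other neighbour `c` of `a` lies above `i`, which
  -- forces `b` below `a`. Applied in both directions around the cycle, it rules out either order of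
  -- `i + 1` and `i - 1`.
  have key : ∀ a b c, (SimpleGraph.cycleGraph (m + 6)).Adj i a →
      (SimpleGraph.cycleGraph (m + 6)).Adj i b → (SimpleGraph.cycleGraph (m + 6)).Adj a c → i ≠ c →
      ¬ (SimpleGraph.cycleGraph (m + 6)).Adj c b → ¬ SideLT o (φ a) (φ b) := by
    intro a b c hia hib hac hic hcb hab
    have hc : (φ c).isLeft = true := by
      rw [bipGraph_isLeft (hφ _ _ hac.symm), ← bipGraph_isLeft (hφ _ _ hia), hi]
    have hlt : SideLT o (φ i) (φ c) := by
      refine (SideLT.or_of_ne o (hi.trans hc.symm) (φ.injective.ne hic)).resolve_right fun h' => ?_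
      exact @not_lt_of_ge _ o.toPreorder _ _ (hmin ⟨c, hc⟩) h'.2
    exact hab.asymm (hlt.step ho (hφ _ _ hib) (hφ _ _ hac.symm) fun h' => hφ' _ _ hcb h'.2)
  have e2 : (1 + 1 : Fin (m + 6)) ≠ 0 := by
    simp only [ne_eq, Fin.ext_iff, Fin.val_add, Fin.val_one, Fin.val_zero]
    rw [Nat.mod_eq_of_lt (by omega)]
    omega
  -- This fails on a four-cycle, where `i + 2` and `i - 1` are adjacent.
  have e4 : (1 + 1 + 1 + 1 : Fin (m + 6)) ≠ 0 := by
    simp only [ne_eq, Fin.ext_iff, Fin.val_add, Fin.val_one, Fin.val_zero]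
    rw [Nat.mod_add_mod, Nat.mod_eq_of_lt (by omega : 1 + 1 < m + 6), Nat.mod_eq_of_lt (by omega)]
    omega
  have hside : (φ (i + 1)).isLeft = (φ (i - 1)).isLeft := by
    rw [bipGraph_isLeft (hφ _ _ (hsucc i).symm), bipGraph_isLeft (hφ _ _ (hpred i).symm)]
  have hne : i + 1 ≠ i - 1 := by
    intro h
    rw [← sub_eq_zero] at h
    exact e2 (by rw [← h]; abel)
  rcases SideLT.or_of_ne o hside (φ.injective.ne hne) with h | h
  · refine key _ _ (i + 1 + 1) (hsucc i) (hpred i) (hsucc _) ?_ ?_ h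
    · intro h'
      rw [eq_comm, ← sub_eq_zero] at h'
      exact e2 (by rw [← h']; abel)
    · rw [SimpleGraph.cycleGraph_adj]
      rintro (h' | h') <;> rw [← sub_eq_zero] at h'
      · exact e2 (by rw [← h']; abel)
      · exact e4 (by rw [← neg_eq_zero, ← h']; abel)
  · refine key _ _ (i - 1 - 1) (hpred i) (hsucc i) (hpred _) ?_ ?_ h
    · intro h'
      rw [← sub_eq_zero] at h'
      exact e2 (by rw [← h']; abel)
    · rw [SimpleGraph.cycleGraph_adj]
      rintro (h' | h') <;> rw [← sub_eq_zero] at h'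
      · exact e4 (by rw [← neg_eq_zero, ← h']; abel)
      · exact e2 (by rw [← h']; abel)

end Digraph

end MinMaxDigraph

open MinMaxDigraph in
theorem corollary2p2 {V : Type*} [Finite V] (H : Digraph V) (hH : IsReflexive H) :
    HasMinMaxOrdering H ↔
      ((∀ k : ℕ, 4 ≤ k → ¬ SimpleGraph.cycleGraph k ⊴ symGraph H) ∧
        ¬ claw ⊴ symGraph H ∧ ¬ net ⊴ symGraph H ∧ ¬ tent ⊴ symGraph H) ∧
      ((∀ k : ℕ, 3 ≤ k → ¬ SimpleGraph.cycleGraph (2 * k) ⊴ bipGraph H) ∧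
        ¬ biclaw ⊴ bipGraph H ∧ ¬ binet ⊴ bipGraph H ∧ ¬ bitent ⊴ bipGraph H) ∧
      (¬ ContainsInducedUpToConverse H1 H ∧ ¬ ContainsInducedUpToConverse H2 H ∧
        ¬ ContainsInducedUpToConverse H3 H ∧ ¬ ContainsInducedUpToConverse H4 H ∧
        ¬ ContainsInducedUpToConverse H5 H ∧ ¬ ContainsInducedUpToConverse H6 H) := by
  constructor
  · intro h
    have sym : ∀ {W : Type} {F : SimpleGraph W}, ¬ HasMinMaxOrdering (loopedDigraph F) →
        ¬ F ⊴ symGraph H := fun hF h' => hF (h.loopedDigraph_of_isIndContained hH h')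
    exact ⟨⟨fun k hk => sym (not_hasMinMaxOrdering_cycleGraph hk), sym not_hasMinMaxOrdering_claw,
        sym not_hasMinMaxOrdering_net, sym not_hasMinMaxOrdering_tent⟩,
      ⟨fun k hk => h.not_cycleGraph hk, h.not_biclaw, h.not_binet, h.not_bitent⟩,
      h.not_containsInducedUpToConverse not_hasMinMaxOrdering_H1,
      h.not_containsInducedUpToConverse not_hasMinMaxOrdering_H2,
      h.not_containsInducedUpToConverse not_hasMinMaxOrdering_H3,
      h.not_containsInducedUpToConverse not_hasMinMaxOrdering_H4,
      h.not_containsInducedUpToConverse not_hasMinMaxOrdering_H5,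
      h.not_containsInducedUpToConverse not_hasMinMaxOrdering_H6⟩
  · rintro ⟨⟨hcycle, hclaw, -, -⟩, ⟨hhole, hbiclaw, hbinet, hbitent⟩, h1, h2, h3, h4, h5, h6⟩
    exact hasMinMaxOrdering_of_isObstructionFree hH
      ⟨h1, h2, h3, h4, h5, h6, hclaw, hcycle 4 le_rfl⟩
      ⟨fun _ _ => bipGraph_isLeft, hhole, hbiclaw, hbinet, hbitent⟩
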